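/- Let $X$ be a complex manifold with holomorphic tangent bundle $\Theta_X$ and cotangent bundle $\Omega_X$, and let $\pi:P\to X$ be a holomorphic principal $\mathbb{C}^\times$-bundle. Let $0\to \mathrm{ad}\,P=\mathcal{O}_X\xrightarrow{\iota} \mathrm{At}\,P\xrightarrow{d\pi}\Theta_X\to 0$ be its Atiyah sequence, where $\mathrm{At}\,P=(\pi_*\Theta_P)^{\mathbb{C}^\times}$, and let $W_P\subset \mathrm{At}\,P\otimes\Omega_X=\mathrm{Hom}(\Theta_X,\mathrm{At}\,P)$ be the preimage of $\mathcal{O}_X\cdot\mathrm{Id}\subset\mathrm{End}\,\Theta_X$ (its fibre at $x$ consists of the pairs $(\lambda,w)$ with $\lambda\in\mathbb{C}$ and $w:T_xX\to(\mathrm{At}\,P)_x$ linear such that $d\pi\circ w=\lambda\,\mathrm{Id}$; it is a holomorphic vector bundle, an extension of $\mathcal{O}_X$ by $\Omega_X$). Put $Z^\circ=\mathrm{Tot}(W_P)$, let $\lambda:Z^\circ\to\mathbb{C}$ be the resulting projection, $C_c=\lambda^{-1}(c)$ for $c\in\mathbb{C}$, and $q:C_c\to X$ the projection. A point $w\in C_c$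 over $x$ defines a $c$-connection at $x$, i.e. a linear map $s_w:(\mathrm{At}\,P)_x\to(\mathrm{ad}\,P)_x=\mathbb{C}$ with $s_w\circ\iota=c$, by $\iota(s_w(u))=c\,u-w(d\pi(u))$. These form the universal $c$-connection on $q^*P$: its $1$-form at a point $(w,p)$ of $q^*P$ is $s_w$ composed with the differential of $q^*P\to P$, where $(\mathrm{At}\,P)_x=T_pP$. For a holomorphic section $\sigma$ of $q^*P$ over an open set $V\subset C_c$, let $A_\sigma$ be the holomorphic $1$-form on $V$ obtained by pulling back this $1$-form along $\sigma$. Identify $T^*X=\mathrm{Tot}(\Omega_X)$ with $C_0$ by letting a covector $\xi$ correspond to the $0$-connection $\xi\circ d\pi:\mathrm{At}\,P\to\Theta_X\to\mathrm{ad}\,P=\mathcal{O}_X$ (that is, to the point $w=-\iota\circ\xi$ of $C_0$). Then there exists a holomorphic relative $2$-form $\omega^\circ\in H^0(Z^\circ,\Omega^2_{Z^\circ/\mathbb{C}})$, relative to $\lambda:Z^\circ\to\mathbb{C}$, such that 1. for every $c\in\mathbb{C}$ the restriction $\omega^\circ|_{C_c}$ is a holomorphic symplectic form, i.e. a closed nondegenerate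 holomorphic $2$-form, on $C_c$; 2. on $C_0=T^*X$ it is the standard holomorphic symplectic form $d\theta$, where $\theta$ is the tautological $1$-form on $T^*X$; 3. for every $c\in\mathbb{C}$, every open $V\subset C_c$ and every holomorphic section $\sigma$ of $q^*P$ over $V$, one has $\omega^\circ|_V=dA_\sigma$. In particular, on $C_1$ the form $\omega^\circ|_{C_1}$ is the curvature of the universal connection on $q^*P$. -/

import Mathlib

open Bundle Set Topology
open scoped Manifold ContDiff

set_option linter.unusedSectionVars false

noncomputable section

namespace CStar

/-! ### Differential forms on manifolds -/

section Forms

variable {F : Type*} [NormedAddCommGroup F] [NormedSpace ℂ F] {H : Type*} [TopologicalSpace H]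
  {I : ModelWithCorners ℂ F H} {M : Type*} [TopologicalSpace M] [ChartedSpace H M]
  {F' : Type*} [NormedAddCommGroup F'] [NormedSpace ℂ F'] {H' : Type*} [TopologicalSpace H']
  {J : ModelWithCorners ℂ F' H'} {N : Type*} [TopologicalSpace N] [ChartedSpace H' N] {n : ℕ}

/-- A (not necessarily holomorphic) field of alternating `ℂ`-multilinear `n`-forms on the tangent
spaces of `M`. -/
abbrev Form (I : ModelWithCorners ℂ F H) (M : Type*) [TopologicalSpace M] [ChartedSpace H M]
    (n : ℕ) : Type _ :=
  ∀ m : M, TangentSpace I m [⋀^Fin n]→L[ℂ] ℂ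

namespace Form

/-- The `1`-form given by a field of covectors. -/
def ofCovectors (θ : ∀ m : M, TangentSpace I m →L[ℂ] ℂ) : Form I M 1 := fun m =>
  ContinuousAlternatingMap.ofSubsingleton ℂ (TangentSpace I m) ℂ (0 : Fin 1) (θ m)

/-- The pullback of a form. -/
def pullback (f : N → M) (η : Form I M n) : Form J N n := fun m =>
  (η (f m)).compContinuousLinearMap (mfderiv J I f m)

/-- The form `η` read in the chart around `m₀`. -/
def inChart (η : Form I M n) (m₀ : M) : F → F [⋀^Fin n]→L[ℂ] ℂ := fun y =>
  (η ((extChartAt I m₀).symm y)).compContinuousLinearMap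
    (mfderivWithin 𝓘(ℂ, F) I (extChartAt I m₀).symm (range I) y)

/-- `η` is holomorphic near `m₀`: its coefficients in the chart are analytic. -/
def HolomorphicAt (η : Form I M n) (m₀ : M) : Prop :=
  ContDiffWithinAt ℂ ω (η.inChart m₀) (range I) (extChartAt I m₀ m₀)

/-- The exterior derivative, computed at each point in the chart around that point. -/
def d (η : Form I M n) : Form I M (n + 1) := fun m₀ =>
  (extDerivWithin (η.inChart m₀) (range I) (extChartAt I m₀ m₀)).compContinuousLinearMap
    (mfderiv I 𝓘(ℂ, F) (extChartAt I m₀) m₀)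

/-- A holomorphic symplectic form: a closed nondegenerate holomorphic `2`-form. -/
structure IsHolomorphicSymplectic (η : Form I M 2) : Prop where
  holomorphic : ∀ m, η.HolomorphicAt m
  closed : ∀ m, η.d m = 0
  nondegenerate : ∀ (m : M) (v : TangentSpace I m),
    (∀ w : TangentSpace I m, η m ![v, w] = 0) → v = 0

end Form

end Forms

/-! ### Principal bundles, the Atiyah bundle and `W_P` -/

section PrincipalBundle

/-- A holomorphic `ℂˣ`-equivariant local trivialization of `P → X`. (The group is abelian, so
left and right actions agree.) -/
structure IsLocalTriv {E : Type*} [NormedAddCommGroup E] [NormedSpace ℂ E]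
    {X : Type*} [TopologicalSpace X] [ChartedSpace E X]
    {EP : Type*} [NormedAddCommGroup EP] [NormedSpace ℂ EP]
    {P : Type*} [TopologicalSpace P] [ChartedSpace EP P] [MulAction ℂˣ P]
    {pr : P → X} (e : Trivialization ℂˣ pr) : Prop where
  contMDiffOn : ContMDiffOn 𝓘(ℂ, EP) (𝓘(ℂ, E).prod 𝓘(ℂ, ℂ)) ω e e.source
  contMDiffOn_symm : ContMDiffOn (𝓘(ℂ, E).prod 𝓘(ℂ, ℂ)) 𝓘(ℂ, EP) ω
    e.toOpenPartialHomeomorph.symm e.target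
  equivariant : ∀ p ∈ e.source, ∀ g : ℂˣ, (e (g • p)).2 = g * (e p).2

/-- A holomorphic principal `ℂˣ`-bundle over the complex manifold `X` with total space the complex
manifold `P`. -/
structure PrincipalBundle (E : Type*) [NormedAddCommGroup E] [NormedSpace ℂ E]
    (X : Type*) [TopologicalSpace X] [ChartedSpace E X]
    (EP : Type*) [NormedAddCommGroup EP] [NormedSpace ℂ EP]
    (P : Type*) [TopologicalSpace P] [ChartedSpace EP P] [MulAction ℂˣ P] where
  proj : P → X
  proj_smul : ∀ (g : ℂˣ) (p : P), proj (g • p) = proj p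
  exists_triv : ∀ x : X, ∃ e : Trivialization ℂˣ proj,
    x ∈ e.baseSet ∧ IsLocalTriv (E := E) (EP := EP) e

variable {E : Type*} [NormedAddCommGroup E] [NormedSpace ℂ E]
  {X : Type*} [TopologicalSpace X] [ChartedSpace E X]
  {EP : Type*} [NormedAddCommGroup EP] [NormedSpace ℂ EP]
  {P : Type*} [TopologicalSpace P] [ChartedSpace EP P] [MulAction ℂˣ P]
  (Q : PrincipalBundle E X EP P)

namespace PrincipalBundle

/-- The fibre `P_x`. -/
abbrev Fib (x : X) : Type _ := {p : P // Q.proj p = x}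

instance (x : X) : SMul ℂˣ (Q.Fib x) := ⟨fun g p => ⟨g • p.1, (Q.proj_smul g p.1).trans p.2⟩⟩

/-- The differential of the action of `g` at `p`. -/
def dAct (g : ℂˣ) (p : P) : TangentSpace 𝓘(ℂ, EP) p →L[ℂ] TangentSpace 𝓘(ℂ, EP) (g • p) :=
  mfderiv 𝓘(ℂ, EP) 𝓘(ℂ, EP) (fun q : P => g • q) p

/-- The differential of the projection at `p`. -/
def dProj (p : P) : TangentSpace 𝓘(ℂ, EP) p →L[ℂ] TangentSpace 𝓘(ℂ, E) (Q.proj p) :=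
  mfderiv 𝓘(ℂ, EP) 𝓘(ℂ, E) Q.proj p

/-- The inclusion `ι` of `Lie ℂˣ = ℂ` in `T_p P`: the differential at `1` of the orbit map. -/
def fund (p : P) : ℂ →L[ℂ] EP :=
  mfderiv 𝓘(ℂ, ℂ) 𝓘(ℂ, EP) (fun g : ℂˣ => g • p) (1 : ℂˣ)

/-- The fibre at `x` of the Atiyah bundle `At P = (π_* Θ_P)^G`: the invariant families of tangent
vectors of `P` along `P_x`. -/
def At (x : X) : Submodule ℂ (∀ p : Q.Fib x, TangentSpace 𝓘(ℂ, EP) p.1) where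
  carrier := {u | ∀ (g : ℂˣ) (p : Q.Fib x), u (g • p) = dAct g p.1 (u p)}
  add_mem' := fun {a b} ha hb g p => by
    have h := map_add (dAct (EP := EP) g p.1) (a p) (b p)
    exact (congrArg₂ (· + ·) (ha g p) (hb g p)).trans h.symm
  zero_mem' := fun g p => (map_zero (dAct (EP := EP) g p.1)).symm
  smul_mem' := fun c a ha g p => by
    have h := map_smul (dAct (EP := EP) g p.1) c (a p)
    exact (congrArg (c • ·) (ha g p)).trans h.symm

/-- The fibre at `x` of `W_P`, that is, of the preimage of `𝒪_X · Id` in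
`At P ⊗ Ω_X = Hom(Θ_X, At P)` : pairs of a scalar `c` and a linear map `w : T_x X → (At P)_x` whose
composition with `At P → Θ_X` is `c · Id`. -/
def W (x : X) : Submodule ℂ (ℂ × (TangentSpace 𝓘(ℂ, E) x →ₗ[ℂ] Q.At x)) where
  carrier := {w | ∀ (v : TangentSpace 𝓘(ℂ, E) x) (p : Q.Fib x),
    Q.dProj p.1 ((w.2 v).1 p) = (w.1 • v : TangentSpace 𝓘(ℂ, E) x)}
  add_mem' := fun {a b} ha hb v p => by
    have h := map_add (Q.dProj p.1) ((a.2 v).1 p) ((b.2 v).1 p)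
    refine h.trans ((congrArg₂ (· + ·) (ha v p) (hb v p)).trans ?_)
    exact (add_smul a.1 b.1 v).symm
  zero_mem' := fun v p => (map_zero (Q.dProj p.1)).trans (zero_smul ℂ v).symm
  smul_mem' := fun c a ha v p => by
    have h := map_smul (Q.dProj p.1) c ((a.2 v).1 p)
    refine h.trans ((congrArg (c • ·) (ha v p)).trans ?_)
    exact (mul_smul c a.1 v).symm

/-! ### Pointwise facts -/

variable {Q}

/-- The fibre coordinate of a trivialization. -/
def coord (e : Trivialization ℂˣ Q.proj) (p : P) : ℂ := ((e p).2 : ℂ)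

/-- The differential of the fibre coordinate. -/
def dcoord (e : Trivialization ℂˣ Q.proj) (p : P) : EP →L[ℂ] ℂ :=
  mfderiv 𝓘(ℂ, EP) 𝓘(ℂ, ℂ) (coord e) p

/-- The logarithmic differential of the fibre coordinate. -/
def dlog (e : Trivialization ℂˣ Q.proj) (p : P) : EP →L[ℂ] ℂ :=
  (coord e p)⁻¹ • dcoord e p

variable {e : Trivialization ℂˣ Q.proj}

theorem coord_ne_zero (p : P) : coord e p ≠ 0 := Units.ne_zero _

theorem smul_mem_source {p : P} (hp : p ∈ e.source) (g : ℂˣ) : g • p ∈ e.source := by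
  rw [e.mem_source] at hp ⊢; rwa [Q.proj_smul]

theorem symm_mul (he : IsLocalTriv (E := E) (EP := EP) e) {x : X} (hx : x ∈ e.baseSet) (g h : ℂˣ) :
    e.toOpenPartialHomeomorph.symm (x, g * h) = g • e.toOpenPartialHomeomorph.symm (x, h) := by
  have ht : (x, h) ∈ e.target := e.mem_target.2 hx
  have hs : e.toOpenPartialHomeomorph.symm (x, h) ∈ e.source :=
    e.toOpenPartialHomeomorph.map_target ht
  have h1 : e (g • e.toOpenPartialHomeomorph.symm (x, h)) = (x, g * h) := by
    refine Prod.ext ?_ ?_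
    · rw [e.coe_fst (smul_mem_source hs g), Q.proj_smul]; exact e.proj_symm_apply ht
    · rw [he.equivariant _ hs]; rw [e.apply_symm_apply ht]
  rw [← h1]
  exact e.toOpenPartialHomeomorph.left_inv (smul_mem_source hs g)

theorem trans_fib {x : X} (p q : Q.Fib x) : ∃ g : ℂˣ, q = g • p := by
  obtain ⟨e, hx, he⟩ := Q.exists_triv x
  have hp : p.1 ∈ e.source := e.mem_source.2 (p.2.symm ▸ hx)
  have hq : q.1 ∈ e.source := e.mem_source.2 (q.2.symm ▸ hx)
  refine ⟨(e q.1).2 * ((e p.1).2)⁻¹, Subtype.ext ?_⟩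
  apply e.toOpenPartialHomeomorph.injOn hq (smul_mem_source hp _)
  refine Prod.ext ?_ ?_
  · change (e _).1 = (e _).1
    rw [e.coe_fst hq, e.coe_fst (smul_mem_source hp _), Q.proj_smul, p.2, q.2]
  · change (e _).2 = (e _).2
    rw [he.equivariant _ hp]; simp

theorem fib_nonempty (Q : PrincipalBundle E X EP P) (x : X) : Nonempty (Q.Fib x) := by
  obtain ⟨e, hx, he⟩ := Q.exists_triv x
  exact ⟨⟨e.toOpenPartialHomeomorph.symm (x, 1), e.proj_symm_apply (e.mem_target.2 hx)⟩⟩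

theorem contMDiffAt_proj (Q : PrincipalBundle E X EP P) (p : P) :
    ContMDiffAt 𝓘(ℂ, EP) 𝓘(ℂ, E) ω Q.proj p := by
  obtain ⟨e, hx, he⟩ := Q.exists_triv (Q.proj p)
  have hs : e.source ∈ 𝓝 p := e.open_source.mem_nhds (e.mem_source.2 hx)
  refine (contMDiffAt_fst.comp p (he.contMDiffOn.contMDiffAt hs)).congr_of_eventuallyEq ?_
  filter_upwards [hs] with q hq using (e.coe_fst hq).symm

theorem contMDiffAt_coord (he : IsLocalTriv (E := E) (EP := EP) e) {p : P} (hp : p ∈ e.source) :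
    ContMDiffAt 𝓘(ℂ, EP) 𝓘(ℂ, ℂ) ω (coord e) p := by
  have hs : e.source ∈ 𝓝 p := e.open_source.mem_nhds hp
  exact Units.contMDiff_val.contMDiffAt.comp p
    (contMDiffAt_snd.comp p (he.contMDiffOn.contMDiffAt hs))

theorem contMDiff_smul_const (Q : PrincipalBundle E X EP P) (g : ℂˣ) :
    ContMDiff 𝓘(ℂ, EP) 𝓘(ℂ, EP) ω (fun q : P => g • q) := by
  intro p
  obtain ⟨e, hx, he⟩ := Q.exists_triv (Q.proj p)
  have hp : p ∈ e.source := e.mem_source.2 hx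
  have hs : e.source ∈ 𝓝 p := e.open_source.mem_nhds hp
  have h1 := he.contMDiffOn.contMDiffAt hs
  have h2 : ContMDiffAt 𝓘(ℂ, EP) (𝓘(ℂ, E).prod 𝓘(ℂ, ℂ)) ω
      (fun q => ((e q).1, g * (e q).2)) p :=
    (contMDiffAt_fst.comp p h1).prodMk
      ((contMDiff_mul_left (I := 𝓘(ℂ, ℂ)) (n := ω) (a := g)).contMDiffAt.comp p
        (contMDiffAt_snd.comp p h1))
  have ht : ((e p).1, g * (e p).2) ∈ e.target := e.mem_target.2 (by rwa [e.coe_fst hp])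
  have h3 := (he.contMDiffOn_symm.contMDiffAt (e.open_target.mem_nhds ht)).comp p h2
  refine h3.congr_of_eventuallyEq ?_
  filter_upwards [hs] with q hq
  have hb : (e q).1 ∈ e.baseSet := by rw [e.coe_fst hq]; exact e.mem_source.1 hq
  change _ = e.toOpenPartialHomeomorph.symm ((e q).1, g * (e q).2)
  rw [symm_mul he hb]
  exact congrArg _ (e.toOpenPartialHomeomorph.left_inv hq).symm

theorem contMDiff_orbit (Q : PrincipalBundle E X EP P) (p : P) :
    ContMDiff 𝓘(ℂ, ℂ) 𝓘(ℂ, EP) ω (fun g : ℂˣ => g • p) := by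
  intro g
  obtain ⟨e, hx, he⟩ := Q.exists_triv (Q.proj p)
  have hp : p ∈ e.source := e.mem_source.2 hx
  have h2 : ContMDiffAt 𝓘(ℂ, ℂ) (𝓘(ℂ, E).prod 𝓘(ℂ, ℂ)) ω
      (fun k : ℂˣ => (Q.proj p, k * (e p).2)) g :=
    contMDiffAt_const.prodMk
      (contMDiff_mul_right (I := 𝓘(ℂ, ℂ)) (n := ω) (a := (e p).2)).contMDiffAt
  have ht : (Q.proj p, g * (e p).2) ∈ e.target := e.mem_target.2 hx
  have h3 := (he.contMDiffOn_symm.contMDiffAt (e.open_target.mem_nhds ht)).comp g h2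
  refine h3.congr_of_eventuallyEq (Filter.Eventually.of_forall fun k => ?_)
  change _ = e.toOpenPartialHomeomorph.symm (Q.proj p, k * (e p).2)
  rw [symm_mul he hx]
  refine congrArg _ ?_
  rw [← e.coe_fst hp]
  exact (e.toOpenPartialHomeomorph.left_inv hp).symm

theorem contMDiffAt_symm_left (he : IsLocalTriv (E := E) (EP := EP) e) {x : X} (hx : x ∈ e.baseSet)
    (h : ℂˣ) : ContMDiffAt 𝓘(ℂ, E) 𝓘(ℂ, EP) ω
      (fun y => e.toOpenPartialHomeomorph.symm (y, h)) x := by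
  have ht : (x, h) ∈ e.target := e.mem_target.2 hx
  exact (he.contMDiffOn_symm.contMDiffAt (e.open_target.mem_nhds ht)).comp x
    (contMDiffAt_id.prodMk contMDiffAt_const)

section Chain

theorem chain {F₁ F₂ F₃ : Type*} [NormedAddCommGroup F₁] [NormedSpace ℂ F₁]
    [NormedAddCommGroup F₂] [NormedSpace ℂ F₂] [NormedAddCommGroup F₃] [NormedSpace ℂ F₃]
    {M₁ M₂ M₃ : Type*} [TopologicalSpace M₁] [TopologicalSpace M₂] [TopologicalSpace M₃]
    [ChartedSpace F₁ M₁] [ChartedSpace F₂ M₂] [ChartedSpace F₃ M₃]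
    {f : M₁ → M₂} {g : M₂ → M₃} {x : M₁} {y : M₂} (hy : f x = y)
    (hg : ContMDiffAt 𝓘(ℂ, F₂) 𝓘(ℂ, F₃) ω g y) (hf : ContMDiffAt 𝓘(ℂ, F₁) 𝓘(ℂ, F₂) ω f x) :
    (mfderiv 𝓘(ℂ, F₁) 𝓘(ℂ, F₃) (g ∘ f) x : F₁ →L[ℂ] F₃) =
      (mfderiv 𝓘(ℂ, F₂) 𝓘(ℂ, F₃) g y : F₂ →L[ℂ] F₃) ∘L
        (mfderiv 𝓘(ℂ, F₁) 𝓘(ℂ, F₂) f x : F₁ →L[ℂ] F₂) := by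
  subst hy
  exact mfderiv_comp x (hg.mdifferentiableAt (by simp)) (hf.mdifferentiableAt (by simp))

theorem mfderiv_unitsVal (g : ℂˣ) :
    (mfderiv 𝓘(ℂ, ℂ) 𝓘(ℂ, ℂ) (Units.val : ℂˣ → ℂ) g : ℂ →L[ℂ] ℂ) = ContinuousLinearMap.id ℂ ℂ :=
  mfderiv_extChartAt_self (I := 𝓘(ℂ, ℂ)) (x := g)

theorem mfderiv_eventuallyEq {F₁ F₂ : Type*} [NormedAddCommGroup F₁] [NormedSpace ℂ F₁]
    [NormedAddCommGroup F₂] [NormedSpace ℂ F₂]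
    {M₁ M₂ : Type*} [TopologicalSpace M₁] [TopologicalSpace M₂]
    [ChartedSpace F₁ M₁] [ChartedSpace F₂ M₂] {f g : M₁ → M₂} {x : M₁} (h : f =ᶠ[𝓝 x] g) :
    (mfderiv 𝓘(ℂ, F₁) 𝓘(ℂ, F₂) f x : F₁ →L[ℂ] F₂) = mfderiv 𝓘(ℂ, F₁) 𝓘(ℂ, F₂) g x :=
  h.mfderiv_eq

theorem mfderiv_const' {F₁ F₂ : Type*} [NormedAddCommGroup F₁] [NormedSpace ℂ F₁]
    [NormedAddCommGroup F₂] [NormedSpace ℂ F₂]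
    {M₁ M₂ : Type*} [TopologicalSpace M₁] [TopologicalSpace M₂]
    [ChartedSpace F₁ M₁] [ChartedSpace F₂ M₂] (c : M₂) (x : M₁) :
    (mfderiv 𝓘(ℂ, F₁) 𝓘(ℂ, F₂) (fun _ : M₁ => c) x : F₁ →L[ℂ] F₂) = 0 :=
  mfderiv_const

theorem inCoordinates_smul_mfderiv {E : Type*} [NormedAddCommGroup E] [NormedSpace ℂ E]
    {X : Type*} [TopologicalSpace X] [ChartedSpace E X] [IsManifold 𝓘(ℂ, E) ω X]
    (x y : X) (c : ℂ) (g : X → ℂ) :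
    ContinuousLinearMap.inCoordinates E (TangentSpace 𝓘(ℂ, E)) ℂ (Bundle.Trivial X ℂ) x y x y
      (c • (mfderiv 𝓘(ℂ, E) 𝓘(ℂ, ℂ) g y : E →L[ℂ] ℂ) : E →L[ℂ] ℂ) =
    c • inTangentCoordinates 𝓘(ℂ, E) 𝓘(ℂ, ℂ) id g (mfderiv 𝓘(ℂ, E) 𝓘(ℂ, ℂ) g) x y := by
  have h1 := Bundle.Trivial.continuousLinearMapAt_trivialization ℂ X ℂ y
  have h2 := TangentBundle.continuousLinearMapAt_model_space (𝕜 := ℂ) (g x) (g y)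
  ext v
  have e1 := DFunLike.congr_fun h1 (c • ((mfderiv 𝓘(ℂ, E) 𝓘(ℂ, ℂ) g y : E →L[ℂ] ℂ)
    (Trivialization.symmL ℂ (trivializationAt E (TangentSpace 𝓘(ℂ, E)) x) y v)))
  have e2 := DFunLike.congr_fun h2 ((mfderiv 𝓘(ℂ, E) 𝓘(ℂ, ℂ) g y : E →L[ℂ] ℂ)
    (Trivialization.symmL ℂ (trivializationAt E (TangentSpace 𝓘(ℂ, E)) x) y v))
  exact e1.trans (congrArg (fun a : ℂ => c • a) e2).symm

end Chain

theorem dProj_fund (p : P) (c : ℂ) : Q.dProj p (fund (EP := EP) p c) = 0 := by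
  have h := chain (f := fun g : ℂˣ => g • p) (x := 1) (one_smul ℂˣ p) (Q.contMDiffAt_proj p)
    (Q.contMDiff_orbit p).contMDiffAt
  have h2 : Q.proj ∘ (fun g : ℂˣ => g • p) = fun _ => Q.proj p := funext fun g => Q.proj_smul g p
  rw [h2, mfderiv_const'] at h
  exact (DFunLike.congr_fun h c).symm

theorem dlog_fund (he : IsLocalTriv (E := E) (EP := EP) e) {p : P} (hp : p ∈ e.source) (c : ℂ) :
    dlog e p (fund (EP := EP) p c) = c := by
  have h := chain (f := fun g : ℂˣ => g • p) (x := 1) (one_smul ℂˣ p) (contMDiffAt_coord he hp) (Q.contMDiff_orbit p).contMDiffAt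
  have h2 : coord e ∘ (fun g : ℂˣ => g • p) = (fun z : ℂ => z * coord e p) ∘ Units.val :=
    funext fun g => by simp [coord, he.equivariant p hp]
  have h3 : ContMDiffAt 𝓘(ℂ, ℂ) 𝓘(ℂ, ℂ) ω (fun z : ℂ => z * coord e p) ((1 : ℂˣ) : ℂ) :=
    (contDiff_id.mul contDiff_const).contMDiff.contMDiffAt
  have h4 := chain rfl h3 (Units.contMDiff_val (n := ω) (𝕜 := ℂ)).contMDiffAt
  rw [h2, h4, mfderiv_unitsVal, mfderiv_eq_fderiv] at h
  have h5 := DFunLike.congr_fun h c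
  have h6 : fderiv ℂ (fun z : ℂ => z * coord e p) ((1 : ℂˣ) : ℂ) c = c * coord e p := by
    rw [fderiv_mul_const differentiableAt_fun_id]; simp [mul_comm]
  have h7 : dcoord (EP := EP) e p (fund (EP := EP) p c)
      = c * coord e p := h5.symm.trans h6
  change (coord e p)⁻¹ * dcoord e p
    (fund (EP := EP) p c) = c
  rw [h7]
  field_simp [coord_ne_zero (e := e) p]

theorem eq_zero_of_dProj_of_dlog (he : IsLocalTriv (E := E) (EP := EP) e) {p : P}
    (hp : p ∈ e.source) (u : TangentSpace 𝓘(ℂ, EP) p) (h1 : Q.dProj p u = 0)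
    (h2 : dlog e p u = 0) : u = 0 := by
  have hs : e.source ∈ 𝓝 p := e.open_source.mem_nhds hp
  have hE := he.contMDiffOn.contMDiffAt hs
  have hfst : ContMDiffAt 𝓘(ℂ, EP) 𝓘(ℂ, E) ω (fun q => (e q).1) p := contMDiffAt_fst.comp p hE
  have hsnd : ContMDiffAt 𝓘(ℂ, EP) 𝓘(ℂ, ℂ) ω (fun q => (e q).2) p := contMDiffAt_snd.comp p hE
  have a1 : (mfderiv 𝓘(ℂ, EP) 𝓘(ℂ, E) (fun q => (e q).1) p : EP →L[ℂ] E) u = 0 := by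
    have : (fun q => (e q).1) =ᶠ[𝓝 p] Q.proj := by
      filter_upwards [hs] with q hq using e.coe_fst hq
    rw [mfderiv_eventuallyEq this]; exact h1
  have a2 : (mfderiv 𝓘(ℂ, EP) 𝓘(ℂ, ℂ) (fun q => (e q).2) p : EP →L[ℂ] ℂ) u = 0 := by
    have h := chain rfl (Units.contMDiff_val (n := ω) (𝕜 := ℂ) (R := ℂ)).contMDiffAt hsnd
    rw [mfderiv_unitsVal] at h
    have h' : dcoord (EP := EP) e p u
      = (mfderiv 𝓘(ℂ, EP) 𝓘(ℂ, ℂ) (fun q => (e q).2) p : EP →L[ℂ] ℂ) u := DFunLike.congr_fun h u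
    rw [← h']
    have h3 : (coord e p)⁻¹ * dcoord e p u = 0 := h2
    exact (mul_eq_zero.1 h3).resolve_left (inv_ne_zero (coord_ne_zero p))
  have a3 := (hfst.mdifferentiableAt (by simp)).hasMFDerivAt.prodMk
    (hsnd.mdifferentiableAt (by simp)).hasMFDerivAt
  have ht : e p ∈ e.target := e.toOpenPartialHomeomorph.map_source hp
  have a4 := ((he.contMDiffOn_symm.contMDiffAt (e.open_target.mem_nhds ht)).mdifferentiableAt
    (by simp)).hasMFDerivAt
  have a5 : HasMFDerivAt 𝓘(ℂ, EP) 𝓘(ℂ, EP) id p _ :=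
    (a4.comp p a3).congr_of_eventuallyEq (by
      filter_upwards [hs] with q hq using (e.toOpenPartialHomeomorph.left_inv hq).symm)
  have a6 := hasMFDerivAt_unique (hasMFDerivAt_id p) a5
  have a7 := DFunLike.congr_fun a6 u
  refine a7.trans ?_
  have a8 : (((mfderiv 𝓘(ℂ, EP) 𝓘(ℂ, E) (fun q => (e q).1) p : EP →L[ℂ] E) u,
    (mfderiv 𝓘(ℂ, EP) 𝓘(ℂ, ℂ) (fun q => (e q).2) p : EP →L[ℂ] ℂ) u) : E × ℂ) = 0 := Prod.ext a1 a2
  exact (congrArg (mfderiv (𝓘(ℂ, E).prod 𝓘(ℂ, ℂ)) 𝓘(ℂ, EP) e.toOpenPartialHomeomorph.symm (e p) :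
    E × ℂ →L[ℂ] EP) a8).trans (map_zero _)

theorem dProj_dAct (g : ℂˣ) (p : P) (u : TangentSpace 𝓘(ℂ, EP) p) :
    Q.dProj (g • p) (dAct g p u) = (Q.dProj p u : E) := by
  have h := chain rfl (Q.contMDiffAt_proj (g • p)) (Q.contMDiff_smul_const g).contMDiffAt
  have h2 : Q.proj ∘ (fun q : P => g • q) = Q.proj := funext fun q => Q.proj_smul g q
  rw [h2] at h
  exact (DFunLike.congr_fun h u).symm

theorem dlog_dAct (he : IsLocalTriv (E := E) (EP := EP) e) {p : P} (hp : p ∈ e.source) (g : ℂˣ)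
    (u : TangentSpace 𝓘(ℂ, EP) p) : dlog (EP := EP) e (g • p) (dAct g p u) = dlog (EP := EP) e p u := by
  have hs : e.source ∈ 𝓝 p := e.open_source.mem_nhds hp
  have h := chain rfl (contMDiffAt_coord he (smul_mem_source hp g))
    (Q.contMDiff_smul_const g).contMDiffAt
  have h2 : coord e ∘ (fun q : P => g • q) =ᶠ[𝓝 p] (fun z : ℂ => (g : ℂ) * z) ∘ coord e := by
    filter_upwards [hs] with q hq
    simp [coord, he.equivariant q hq]
  have h3 : ContMDiffAt 𝓘(ℂ, ℂ) 𝓘(ℂ, ℂ) ω (fun z : ℂ => (g : ℂ) * z) (coord e p) :=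
    (contDiff_const.mul contDiff_id).contMDiff.contMDiffAt
  have h4 := chain rfl h3 (contMDiffAt_coord he hp)
  rw [mfderiv_eventuallyEq h2, h4, mfderiv_eq_fderiv] at h
  have h5 := DFunLike.congr_fun h u
  have h6 (c : ℂ) : fderiv ℂ (fun z : ℂ => (g : ℂ) * z) (coord e p) c = g * c := by
    rw [fderiv_const_mul differentiableAt_fun_id]; simp
  have h7 : dcoord (EP := EP) e (g • p) (dAct (EP := EP) g p u) =
      g * dcoord (EP := EP) e p u := h5.symm.trans (h6 _)
  change (coord e (g • p))⁻¹ * dcoord e (g • p)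
    (dAct (EP := EP) g p u) = (coord e p)⁻¹ * dcoord e p u
  have h8 : coord e (g • p) = g * coord e p := by simp [coord, he.equivariant p hp]
  rw [h7, h8]
  have := coord_ne_zero (e := e) p
  have := Units.ne_zero g
  field_simp

theorem fund_smul (Q : PrincipalBundle E X EP P) (g : ℂˣ) (p : P) (c : ℂ) :
    fund (EP := EP) (g • p) c = dAct (EP := EP) g p (fund (EP := EP) p c) := by
  have h := chain (f := fun g : ℂˣ => g • p) (x := 1) (one_smul ℂˣ p) (Q.contMDiff_smul_const g p) (Q.contMDiff_orbit p).contMDiffAt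
  have h2 : (fun q : P => g • q) ∘ (fun k : ℂˣ => k • p) = fun k : ℂˣ => k • g • p :=
    funext fun k => smul_comm g k p
  rw [h2] at h
  exact DFunLike.congr_fun h c

/-- The horizontal lift at `p` defined by the trivialization `e`. -/
def lift (e : Trivialization ℂˣ Q.proj) (p : P) : E →L[ℂ] EP :=
  mfderiv 𝓘(ℂ, E) 𝓘(ℂ, EP) (fun y => e.toOpenPartialHomeomorph.symm (y, (e p).2)) (Q.proj p)

theorem symm_self {p : P} (hp : p ∈ e.source) :
    e.toOpenPartialHomeomorph.symm (Q.proj p, (e p).2) = p := by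
  rw [← e.coe_fst hp]; exact e.toOpenPartialHomeomorph.left_inv hp

theorem dProj_lift (he : IsLocalTriv (E := E) (EP := EP) e) {p : P} (hp : p ∈ e.source) (v : E) :
    Q.dProj p (lift e p v) = v := by
  have hb := e.mem_source.1 hp
  have h := chain (f := fun y => e.toOpenPartialHomeomorph.symm (y, (e p).2)) (x := Q.proj p) (symm_self hp) (Q.contMDiffAt_proj p) (contMDiffAt_symm_left he hb (e p).2)
  have h2 : Q.proj ∘ (fun y => e.toOpenPartialHomeomorph.symm (y, (e p).2)) =ᶠ[𝓝 (Q.proj p)] id := by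
    filter_upwards [e.open_baseSet.mem_nhds hb] with y hy
    exact e.proj_symm_apply (e.mem_target.2 hy)
  rw [mfderiv_eventuallyEq h2] at h
  have h3 : (mfderiv 𝓘(ℂ, E) 𝓘(ℂ, E) (id : X → X) (Q.proj p) : E →L[ℂ] E) v = v := by
    rw [mfderiv_id]; rfl
  exact (DFunLike.congr_fun h v).symm.trans h3

theorem dlog_lift (he : IsLocalTriv (E := E) (EP := EP) e) {p : P} (hp : p ∈ e.source) (v : E) :
    dlog e p (lift e p v) = 0 := by
  have hb := e.mem_source.1 hp
  have h := chain (f := fun y => e.toOpenPartialHomeomorph.symm (y, (e p).2)) (x := Q.proj p) (symm_self hp) (contMDiffAt_coord he hp) (contMDiffAt_symm_left he hb (e p).2)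
  have h2 : coord e ∘ (fun y => e.toOpenPartialHomeomorph.symm (y, (e p).2)) =ᶠ[𝓝 (Q.proj p)]
      fun _ => coord e p := by
    filter_upwards [e.open_baseSet.mem_nhds hb] with y hy
    simp [coord, e.apply_symm_apply (e.mem_target.2 hy : (y, (e p).2) ∈ e.target)]
  rw [mfderiv_eventuallyEq h2, mfderiv_const'] at h
  have h3 : dcoord (EP := EP) e p (lift e p v) = 0 :=
    (DFunLike.congr_fun h v).symm
  change (coord e p)⁻¹ * dcoord e p (lift e p v) = 0
  rw [h3, mul_zero]

theorem ext_of_dProj_of_dlog (he : IsLocalTriv (E := E) (EP := EP) e) {p : P}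
    (hp : p ∈ e.source) {u u' : TangentSpace 𝓘(ℂ, EP) p} (h1 : Q.dProj p u = Q.dProj p u')
    (h2 : dlog e p u = dlog e p u') : u = u' :=
  sub_eq_zero.1 (eq_zero_of_dProj_of_dlog he hp _ ((map_sub (Q.dProj p) u u').trans
    (sub_eq_zero.2 h1)) ((map_sub (dlog e p) u u').trans (sub_eq_zero.2 h2)))

theorem lift_smul (he : IsLocalTriv (E := E) (EP := EP) e) {p : P} (hp : p ∈ e.source) (g : ℂˣ)
    (v : E) : lift e (g • p) v = dAct (EP := EP) g p (lift e p v) := by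
  refine ext_of_dProj_of_dlog he (smul_mem_source hp g) ?_ ?_
  · exact (dProj_lift he (smul_mem_source hp g) v).trans
      ((dProj_dAct g p _).trans (dProj_lift he hp v)).symm
  · exact (dlog_lift he (smul_mem_source hp g) v).trans
      ((dlog_dAct he hp g _).trans (dlog_lift he hp v)).symm

theorem eq_fund_of_dProj_eq_zero {p : P} {u : TangentSpace 𝓘(ℂ, EP) p} (h : Q.dProj p u = 0) :
    ∃ c : ℂ, fund (EP := EP) p c = u := by
  obtain ⟨e, hx, he⟩ := Q.exists_triv (Q.proj p)
  have hp : p ∈ e.source := e.mem_source.2 hx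
  exact ⟨dlog (EP := EP) e p u, ext_of_dProj_of_dlog he hp ((dProj_fund p _).trans h.symm) (dlog_fund he hp _)⟩

theorem fund_injective (Q : PrincipalBundle E X EP P) (p : P) :
    Function.Injective (fund (EP := EP) p) := by
  obtain ⟨e, hx, he⟩ := Q.exists_triv (Q.proj p)
  have hp : p ∈ e.source := e.mem_source.2 hx
  intro a b h
  rw [← dlog_fund he hp a, h, dlog_fund he hp b]

/-! ### The vector bundle structure of `W_P` -/

/-- The fibre of the vector bundle `W_P`. -/
def WFib (Q : PrincipalBundle E X EP P) (x : X) : Type _ := Q.W x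

instance (x : X) : AddCommMonoid (Q.WFib x) := inferInstanceAs (AddCommMonoid (Q.W x))
instance (x : X) : Module ℂ (Q.WFib x) := inferInstanceAs (Module ℂ (Q.W x))

/-- The component in `𝒪_X` of an element of `W_P`. -/
def WFib.scalar {x : X} (w : Q.WFib x) : ℂ := w.1.1

/-- The value at `p ∈ P_x` of the invariant family `w(v) ∈ (At P)_x`. -/
def WFib.val {x : X} (w : Q.WFib x) (v : TangentSpace 𝓘(ℂ, E) x) (p : Q.Fib x) :
    TangentSpace 𝓘(ℂ, EP) p.1 := (w.1.2 v).1 p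

theorem WFib.val_smul {x : X} (w : Q.WFib x) (v : TangentSpace 𝓘(ℂ, E) x) (g : ℂˣ) (p : Q.Fib x) :
    w.val v (g • p) = dAct g p.1 (w.val v p) := (w.1.2 v).2 g p

theorem WFib.dProj_val {x : X} (w : Q.WFib x) (v : TangentSpace 𝓘(ℂ, E) x) (p : Q.Fib x) :
    Q.dProj p.1 (w.val v p) = (w.scalar • v : TangentSpace 𝓘(ℂ, E) x) := w.2 v p

/-- A point of the fibre `P_x`. -/
def pt (Q : PrincipalBundle E X EP P) (x : X) : Q.Fib x := (Q.fib_nonempty x).some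

theorem fib_mem_source {x : X} (hx : x ∈ e.baseSet) (p : Q.Fib x) : p.1 ∈ e.source :=
  e.mem_source.2 (p.2.symm ▸ hx)

theorem WFib.ext_val {x : X} {w w' : Q.WFib x} (h1 : w.scalar = w'.scalar)
    (h2 : ∀ v p, w.val v p = w'.val v p) : w = w' :=
  Subtype.ext (Prod.ext h1 (LinearMap.ext fun v => Subtype.ext (funext fun p => h2 v p)))

/-- A local trivialization of `P` around `x`. -/
def triv (Q : PrincipalBundle E X EP P) (x : X) : Trivialization ℂˣ Q.proj :=
  (Q.exists_triv x).choose

theorem mem_triv (Q : PrincipalBundle E X EP P) (x : X) : x ∈ (Q.triv x).baseSet :=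
  (Q.exists_triv x).choose_spec.1

theorem isLocalTriv_triv (Q : PrincipalBundle E X EP P) (x : X) :
    IsLocalTriv (E := E) (EP := EP) (Q.triv x) :=
  (Q.exists_triv x).choose_spec.2

variable [FiniteDimensional ℂ E]

/-- The component in `Ω_X` of an element of `W_P` with respect to a local trivialization of `P`. -/
def cotan (e : Trivialization ℂˣ Q.proj) {x : X} (w : Q.WFib x) : E →L[ℂ] ℂ :=
  LinearMap.toContinuousLinearMap
    { toFun := fun v : E => dlog e (Q.pt x).1 (w.val v (Q.pt x))
      map_add' := fun a b => by
        have h : w.val (a + b : E) (Q.pt x) = w.val a (Q.pt x) + w.val b (Q.pt x) :=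
          congrArg (fun u : Q.At x => u.1 (Q.pt x)) (map_add w.1.2 a b)
        rw [h]; exact map_add (dlog e (Q.pt x).1) _ _
      map_smul' := fun c a => by
        have h : w.val (c • a : E) (Q.pt x) = c • w.val a (Q.pt x) :=
          congrArg (fun u : Q.At x => u.1 (Q.pt x)) (map_smul w.1.2 c a)
        rw [h]; exact map_smul (dlog e (Q.pt x).1) _ _ }

theorem cotan_apply (he : IsLocalTriv (E := E) (EP := EP) e) {x : X} (hx : x ∈ e.baseSet)
    (w : Q.WFib x) (v : TangentSpace 𝓘(ℂ, E) x) (p : Q.Fib x) : cotan e w v = dlog e p.1 (w.val v p) := by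
  obtain ⟨g, hg⟩ := trans_fib (Q.pt x) p
  subst hg
  exact (dlog_dAct he (fib_mem_source hx _) g _).symm.trans (congrArg _ (w.val_smul v g (Q.pt x)).symm)

/-- The linear map `v ↦ c · (horizontal lift of v) + ι (a v)`. -/
def ofL (e : Trivialization ℂˣ Q.proj) (c : ℂ) (a : E →L[ℂ] ℂ) (p : P) : E →L[ℂ] EP :=
  c • lift e p + (fund p) ∘L a

/-- The element of `W_P` with given components. -/
def ofCotan (he : IsLocalTriv (E := E) (EP := EP) e) {x : X} (hx : x ∈ e.baseSet) (c : ℂ)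
    (a : E →L[ℂ] ℂ) : Q.WFib x :=
  ⟨(c,
    { toFun := fun v => ⟨fun p => ofL e c a p.1 v, fun g p => by
        have h1 := lift_smul he (fib_mem_source hx p) g v
        have h2 := fund_smul Q g p.1 (a v)
        have h3 := map_add (dAct (EP := EP) g p.1) (c • lift e p.1 v : EP) (fund p.1 (a v))
        have h4 := map_smul (dAct (EP := EP) g p.1) c (lift e p.1 v : EP)
        exact (congrArg₂ (fun a b : EP => a + b)
          ((congrArg (fun a : EP => c • a) h1).trans h4.symm) h2).trans h3.symm⟩
      map_add' := fun v v' =>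
        Subtype.ext (funext fun p => map_add (ofL (EP := EP) e c a p.1) v v')
      map_smul' := fun k v =>
        Subtype.ext (funext fun p => map_smul (ofL (EP := EP) e c a p.1) k v) }),
   fun v p => by
    have h1 := dProj_lift he (fib_mem_source hx p) v
    have h2 := Q.dProj_fund p.1 (a v)
    have h3 := map_add (Q.dProj p.1) (c • lift e p.1 v : EP) (fund p.1 (a v))
    have h4 := map_smul (Q.dProj p.1) c (lift e p.1 v : EP)
    refine h3.trans ((congrArg₂ (· + ·) (h4.trans (congrArg (c • ·) h1)) h2).trans ?_)
    exact add_zero (c • v : E)⟩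

theorem ofCotan_cotan (he : IsLocalTriv (E := E) (EP := EP) e) {x : X} (hx : x ∈ e.baseSet)
    (w : Q.WFib x) : ofCotan he hx w.scalar (cotan e w) = w := by
  refine WFib.ext_val rfl fun v p => ?_
  have hp := fib_mem_source hx p
  refine ext_of_dProj_of_dlog he hp ?_ ?_
  · exact ((ofCotan he hx w.scalar (cotan e w)).dProj_val v p).trans (w.dProj_val v p).symm
  · have h3 := map_add (dlog e p.1) (w.scalar • lift e p.1 v : EP) (fund p.1 (cotan e w v))
    have h4 := map_smul (dlog e p.1) w.scalar (lift e p.1 v : EP)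
    have h1 := dlog_lift he hp v
    refine h3.trans ((congrArg₂ (· + ·) (h4.trans (congrArg (w.scalar • ·) h1))
      (dlog_fund he hp _)).trans ?_)
    rw [smul_zero, zero_add]
    exact cotan_apply he hx w v p

theorem cotan_ofCotan (he : IsLocalTriv (E := E) (EP := EP) e) {x : X} (hx : x ∈ e.baseSet)
    (c : ℂ) (a : E →L[ℂ] ℂ) : cotan e (ofCotan he hx c a) = a := by
  ext v
  have hp := fib_mem_source hx (Q.pt x)
  have h3 := map_add (dlog e (Q.pt x).1) (c • lift e (Q.pt x).1 v : EP) (fund (Q.pt x).1 (a v))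
  have h4 := map_smul (dlog e (Q.pt x).1) c (lift e (Q.pt x).1 v : EP)
  have h1 := dlog_lift he hp v
  refine h3.trans ((congrArg₂ (· + ·) (h4.trans (congrArg (c • ·) h1)) (dlog_fund he hp _)).trans ?_)
  rw [smul_zero, zero_add]

theorem cotan_add (e : Trivialization ℂˣ Q.proj) {x : X} (w w' : Q.WFib x) :
    cotan e (w + w') = cotan e w + cotan e w' := by
  ext v; exact map_add (dlog e (Q.pt x).1) (w.val v (Q.pt x)) (w'.val v (Q.pt x))

theorem cotan_smul (e : Trivialization ℂˣ Q.proj) {x : X} (c : ℂ) (w : Q.WFib x) :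
    cotan e (c • w) = c • cotan e w := by
  ext v; exact map_smul (dlog e (Q.pt x).1) c (w.val v (Q.pt x))

/-- The logarithmic differential `dg · g⁻¹` of the transition function between two
trivializations. -/
def transDlog (e e' : Trivialization ℂˣ Q.proj) (x : X) : E →L[ℂ] ℂ :=
  ((coord e' (e.toOpenPartialHomeomorph.symm (x, 1)))⁻¹ •
    (mfderiv 𝓘(ℂ, E) 𝓘(ℂ, ℂ) (fun y => coord e' (e.toOpenPartialHomeomorph.symm (y, 1))) x :
      E →L[ℂ] ℂ) : E →L[ℂ] ℂ)

theorem cotan_change {e' : Trivialization ℂˣ Q.proj} (he : IsLocalTriv (E := E) (EP := EP) e)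
    (he' : IsLocalTriv (E := E) (EP := EP) e') {x : X} (hx : x ∈ e.baseSet) (hx' : x ∈ e'.baseSet)
    (w : Q.WFib x) : cotan e' w = cotan e w + w.scalar • transDlog e e' x := by
  ext v
  let p : Q.Fib x := ⟨e.toOpenPartialHomeomorph.symm (x, 1), e.proj_symm_apply (e.mem_target.2 hx)⟩
  have hp := fib_mem_source hx p
  have hp' := fib_mem_source hx' p
  have hw := ofCotan_cotan he hx w
  have e1 : cotan e' w v = dlog e' p.1 ((ofCotan he hx w.scalar (cotan e w)).val v p) := by
    rw [hw]; exact cotan_apply he' hx' w v p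
  have h3 := map_add (dlog e' p.1) (w.scalar • lift e p.1 v : EP) (fund p.1 (cotan e w v))
  have h4 := map_smul (dlog e' p.1) w.scalar (lift e p.1 v : EP)
  have h5 : dlog e' p.1 (lift e p.1 v) = transDlog e e' x v := by
    have h6 : (e p.1).2 = 1 := by
      change (e (e.toOpenPartialHomeomorph.symm (x, 1))).2 = 1
      rw [e.apply_symm_apply (e.mem_target.2 hx)]
    have h7 := chain (f := fun y => e.toOpenPartialHomeomorph.symm (y, (1 : ℂˣ))) (x := x) rfl
      (contMDiffAt_coord he' hp') (contMDiffAt_symm_left he hx 1)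
    have h8 : (lift e p.1 : E →L[ℂ] EP) = (mfderiv 𝓘(ℂ, E) 𝓘(ℂ, EP)
        (fun y => e.toOpenPartialHomeomorph.symm (y, (1 : ℂˣ))) x : E →L[ℂ] EP) := by
      unfold lift; rw [h6, p.2]
    rw [h8]
    exact congrArg ((coord e' p.1)⁻¹ * ·) (DFunLike.congr_fun h7 v).symm
  rw [e1]
  refine h3.trans ((congrArg₂ (· + ·) (h4.trans (congrArg (w.scalar • ·) h5))
    (dlog_fund he' hp' _)).trans ?_)
  exact add_comm _ _

variable [IsManifold 𝓘(ℂ, E) ω X]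

/-- The holomorphic cotangent bundle `Ω_X`. -/
abbrev Cot (E : Type*) [NormedAddCommGroup E] [NormedSpace ℂ E]
    (X : Type*) [TopologicalSpace X] [ChartedSpace E X] (x : X) : Type _ :=
  TangentSpace 𝓘(ℂ, E) x →L[ℂ] Bundle.Trivial X ℂ x

/-- Reading a covector on the model space as a covector at `x` (the tangent space at `x` is a copy
of the model space). -/
def toCot {E : Type*} [NormedAddCommGroup E] [NormedSpace ℂ E]
    {X : Type*} [TopologicalSpace X] [ChartedSpace E X] (x : X) (a : E →L[ℂ] ℂ) : Cot E X x := a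

/-- Inverse of `toCot`. -/
def ofCot {E : Type*} [NormedAddCommGroup E] [NormedSpace ℂ E]
    {X : Type*} [TopologicalSpace X] [ChartedSpace E X] {x : X} (a : Cot E X x) : E →L[ℂ] ℂ := a

/-- The standard local trivialization of `Ω_X` around `x₀`. -/
abbrev cotTriv (E : Type*) [NormedAddCommGroup E] [NormedSpace ℂ E]
    {X : Type*} [TopologicalSpace X] [ChartedSpace E X] [IsManifold 𝓘(ℂ, E) ω X] (x₀ : X) :
    Trivialization (E →L[ℂ] ℂ)
      (TotalSpace.proj : TotalSpace (E →L[ℂ] ℂ) (Cot E X) → X) :=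
  trivializationAt (E →L[ℂ] ℂ) (Cot E X) x₀

/-- The local trivialization of `W_P` induced by a local trivialization `e` of `P` and the
standard local trivialization of `Ω_X` around `x₀`. -/
def pretriv (he : IsLocalTriv (E := E) (EP := EP) e) (x₀ : X) :
    Pretrivialization (ℂ × (E →L[ℂ] ℂ))
      (TotalSpace.proj : TotalSpace (ℂ × (E →L[ℂ] ℂ)) Q.WFib → X) where
  toFun z := (z.1, z.2.scalar, (cotTriv E x₀ ⟨z.1, toCot z.1 (cotan e z.2)⟩).2)
  invFun y := ⟨y.1, open Classical in if h : y.1 ∈ e.baseSet then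
    ofCotan he h y.2.1 (ofCot ((cotTriv E x₀).symm y.1 y.2.2)) else 0⟩
  source := TotalSpace.proj ⁻¹' (e.baseSet ∩ (cotTriv E x₀).baseSet)
  target := (e.baseSet ∩ (cotTriv E x₀).baseSet) ×ˢ univ
  map_source' z hz := ⟨hz, trivial⟩
  map_target' y hy := hy.1
  left_inv' := by
    rintro ⟨x, w⟩ ⟨h1, h2⟩
    have h1' : x ∈ e.baseSet := h1
    simp only [h1', dite_true]
    refine congrArg (TotalSpace.mk x) ?_
    rw [(cotTriv E x₀).symm_apply_apply_mk h2]
    exact ofCotan_cotan he h1 w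
  right_inv' := by
    rintro ⟨x, c, η⟩ ⟨⟨h1, h2⟩, -⟩
    have h1' : x ∈ e.baseSet := h1
    simp only [h1', dite_true]
    refine Prod.ext rfl (Prod.ext rfl ?_)
    change (cotTriv E x₀ ⟨x, toCot x (cotan e (ofCotan he h1 c (ofCot ((cotTriv E x₀).symm x η))))⟩).2 = η
    rw [cotan_ofCotan he h1]
    exact congrArg Prod.snd ((cotTriv E x₀).apply_mk_symm h2 η)
  open_target := (e.open_baseSet.inter (cotTriv E x₀).open_baseSet).prod isOpen_univ
  baseSet := e.baseSet ∩ (cotTriv E x₀).baseSet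
  open_baseSet := e.open_baseSet.inter (cotTriv E x₀).open_baseSet
  source_eq := rfl
  target_eq := rfl
  proj_toFun _ _ := rfl

theorem pretriv_symm (he : IsLocalTriv (E := E) (EP := EP) e) (x₀ : X) {x : X}
    (hx : x ∈ e.baseSet ∩ (cotTriv E x₀).baseSet) (y : ℂ × (E →L[ℂ] ℂ)) :
    (pretriv he x₀).symm x y = ofCotan he hx.1 y.1 (ofCot ((cotTriv E x₀).symm x y.2)) := by
  have h := (pretriv he x₀).mk_symm hx y
  have h1 : x ∈ e.baseSet := hx.1
  have h2 : (pretriv he x₀).toPartialEquiv.symm (x, y) =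
      ⟨x, ofCotan he hx.1 y.1 (ofCot ((cotTriv E x₀).symm x y.2))⟩ := by
    refine congrArg (TotalSpace.mk x) ?_
    exact dif_pos h1
  exact TotalSpace.mk_injective x (h.trans h2)

theorem contMDiffOn_transDlog {e' : Trivialization ℂˣ Q.proj}
    (he : IsLocalTriv (E := E) (EP := EP) e) (he' : IsLocalTriv (E := E) (EP := EP) e') (x₀ : X) :
    ContMDiffOn 𝓘(ℂ, E) 𝓘(ℂ, E →L[ℂ] ℂ) ω
      (fun x => (cotTriv E x₀ ⟨x, toCot x (transDlog e e' x)⟩).2)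
      (e.baseSet ∩ e'.baseSet ∩ (cotTriv E x₀).baseSet) := by
  have hsub : e.baseSet ∩ e'.baseSet ∩ (cotTriv E x₀).baseSet ⊆ (cotTriv E x₀).baseSet :=
    inter_subset_right
  have hopen : IsOpen (e.baseSet ∩ e'.baseSet ∩ (cotTriv E x₀).baseSet) :=
    (e.open_baseSet.inter e'.open_baseSet).inter (cotTriv E x₀).open_baseSet
  refine ((cotTriv E x₀).contMDiffOn_section_iff (IB := 𝓘(ℂ, E)) (n := ω)
    (s := fun x => toCot x (transDlog e e' x)) hopen hsub).1 ?_
  rintro x ⟨⟨hx, hx'⟩, -⟩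
  refine ContMDiffAt.contMDiffWithinAt ?_
  let g : X → ℂ := fun y => coord e' (e.toOpenPartialHomeomorph.symm (y, 1))
  have hmem : e.toOpenPartialHomeomorph.symm (x, 1) ∈ e'.source :=
    e'.mem_source.2 ((e.proj_symm_apply (e.mem_target.2 hx : (x, (1 : ℂˣ)) ∈ e.target)).symm ▸ hx')
  have hg : ContMDiffAt 𝓘(ℂ, E) 𝓘(ℂ, ℂ) ω g x :=
    ContMDiffAt.comp (f := fun y => e.toOpenPartialHomeomorph.symm (y, (1 : ℂˣ))) x (contMDiffAt_coord he' hmem) (contMDiffAt_symm_left he hx 1)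
  have hg0 : g x ≠ 0 := coord_ne_zero _
  have hinv : ContMDiffAt 𝓘(ℂ, E) 𝓘(ℂ, ℂ) ω (fun y => (g y)⁻¹) x :=
    ((contDiffAt_inv ℂ hg0).contMDiffAt).comp x hg
  have hd := hg.mfderiv_const (m := ω) (by simp)
  rw [contMDiffAt_hom_bundle]
  refine ⟨contMDiffAt_id, ?_⟩
  refine (hinv.smul hd).congr_of_eventuallyEq (Filter.Eventually.of_forall fun y => ?_)
  exact inCoordinates_smul_mfderiv x y (g y)⁻¹ g

theorem exists_coordChange {e' : Trivialization ℂˣ Q.proj}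
    (he : IsLocalTriv (E := E) (EP := EP) e) (he' : IsLocalTriv (E := E) (EP := EP) e')
    (x₀ x₁ : X) :
    ∃ f : X → (ℂ × (E →L[ℂ] ℂ)) →L[ℂ] (ℂ × (E →L[ℂ] ℂ)),
      ContMDiffOn 𝓘(ℂ, E) 𝓘(ℂ, (ℂ × (E →L[ℂ] ℂ)) →L[ℂ] (ℂ × (E →L[ℂ] ℂ))) ω f
        ((pretriv he x₀).baseSet ∩ (pretriv he' x₁).baseSet) ∧
      ∀ b ∈ (pretriv he x₀).baseSet ∩ (pretriv he' x₁).baseSet, ∀ v,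
        f b v = (pretriv he' x₁ ⟨b, (pretriv he x₀).symm b v⟩).2 := by
  let d : X → (E →L[ℂ] ℂ) := fun x => (cotTriv E x₁ ⟨x, toCot x (transDlog e e' x)⟩).2
  let k : X → (E →L[ℂ] ℂ) →L[ℂ] (E →L[ℂ] ℂ) := fun x =>
    ((cotTriv E x₀).coordChangeL ℂ (cotTriv E x₁) x : (E →L[ℂ] ℂ) →L[ℂ] (E →L[ℂ] ℂ))
  have hd := contMDiffOn_transDlog he he' x₁
  have hk : ContMDiffOn 𝓘(ℂ, E) 𝓘(ℂ, (E →L[ℂ] ℂ) →L[ℂ] (E →L[ℂ] ℂ)) ω k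
    ((cotTriv E x₀).baseSet ∩ (cotTriv E x₁).baseSet) :=
    contMDiffOn_coordChangeL (IB := 𝓘(ℂ, E)) (cotTriv E x₀) (cotTriv E x₁)
  let Φ : ((E →L[ℂ] ℂ) →L[ℂ] (E →L[ℂ] ℂ)) × (E →L[ℂ] ℂ) →
      ((ℂ × (E →L[ℂ] ℂ)) →L[ℂ] (ℂ × (E →L[ℂ] ℂ))) := fun q =>
    (ContinuousLinearMap.inl ℂ ℂ (E →L[ℂ] ℂ)).comp (ContinuousLinearMap.fst ℂ ℂ (E →L[ℂ] ℂ)) +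
    (ContinuousLinearMap.inr ℂ ℂ (E →L[ℂ] ℂ)).comp
      (q.1.comp (ContinuousLinearMap.snd ℂ ℂ (E →L[ℂ] ℂ)) +
        (ContinuousLinearMap.fst ℂ ℂ (E →L[ℂ] ℂ)).smulRight q.2)
  have hΦ : ContDiff ℂ ω Φ := by
    refine contDiff_const.add (contDiff_const.clm_comp (ContDiff.add ?_ ?_))
    · exact contDiff_fst.clm_comp contDiff_const
    · exact contDiff_const.smulRight contDiff_snd
  refine ⟨fun x => Φ (k x, d x), ?_, ?_⟩
  · refine hΦ.contMDiff.comp_contMDiffOn (ContMDiffOn.prodMk_space (hk.mono ?_) (hd.mono ?_))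
    · rintro x ⟨⟨-, h⟩, -, h'⟩; exact ⟨h, h'⟩
    · rintro x ⟨⟨h, -⟩, h', h''⟩; exact ⟨⟨h, h'⟩, h''⟩
  · rintro x ⟨h, h'⟩ ⟨c, η⟩
    rw [pretriv_symm he x₀ h]
    have h3 : k x η = (cotTriv E x₁ ⟨x, (cotTriv E x₀).symm x η⟩).2 :=
      (cotTriv E x₀).coordChangeL_apply (cotTriv E x₁) ⟨h.2, h'.2⟩ η
    have hl := (cotTriv E x₁).linear ℂ h'.2
    have h4 := cotan_change he he' h.1 h'.1 (ofCotan he h.1 c (ofCot ((cotTriv E x₀).symm x η)))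
    rw [cotan_ofCotan he h.1 c (ofCot ((cotTriv E x₀).symm x η))] at h4
    refine Prod.ext ?_ ?_
    · change c + 0 = c
      exact add_zero c
    · change 0 + (k x η + c • d x) = (cotTriv E x₁ ⟨x, toCot x (cotan e' (ofCotan he h.1 c (ofCot ((cotTriv E x₀).symm x η))))⟩).2
      rw [h4, zero_add, h3]
      refine Eq.trans ?_ (hl.map_add ((cotTriv E x₀).symm x η) (c • toCot x (transDlog e e' x))).symm
      refine congrArg _ ?_
      exact (hl.map_smul c (toCot x (transDlog e e' x))).symm

/-- The topology of the (finite-dimensional) fibres of `W_P`. -/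
instance (x : X) : TopologicalSpace (Q.WFib x) :=
  .induced (fun w : Q.WFib x => pretriv (isLocalTriv_triv Q x) x ⟨x, w⟩) inferInstance

/-- The local trivializations of `W_P` induced by all local trivializations of `P` and charts
of `X`. They are pairwise compatible. -/
def prebundle (Q : PrincipalBundle E X EP P) :
    VectorPrebundle ℂ (ℂ × (E →L[ℂ] ℂ)) Q.WFib where
  pretrivializationAtlas := {f | ∃ (e : Trivialization ℂˣ Q.proj)
    (he : IsLocalTriv (E := E) (EP := EP) e) (x₀ : X), f = pretriv he x₀}
  pretrivialization_linear' := by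
    rintro _ ⟨e, he, x₀, rfl⟩
    refine ⟨fun x hx => ⟨fun w w' => ?_, fun c w => ?_⟩⟩
    · refine Prod.ext rfl ?_
      change (cotTriv E x₀ ⟨x, toCot x (cotan e (w + w'))⟩).2 = _
      rw [cotan_add]
      exact ((cotTriv E x₀).linear ℂ hx.2).map_add (toCot x (cotan e w)) (toCot x (cotan e w'))
    · refine Prod.ext rfl ?_
      change (cotTriv E x₀ ⟨x, toCot x (cotan e (c • w))⟩).2 = _
      rw [cotan_smul]
      exact ((cotTriv E x₀).linear ℂ hx.2).map_smul c (toCot x (cotan e w))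
  pretrivializationAt x := pretriv (isLocalTriv_triv Q x) x
  mem_base_pretrivializationAt x := ⟨mem_triv Q x, mem_baseSet_trivializationAt _ _ x⟩
  pretrivialization_mem_atlas x := ⟨_, _, _, rfl⟩
  exists_coordChange := by
    rintro _ ⟨e, he, x₀, rfl⟩ _ ⟨e', he', x₁, rfl⟩
    obtain ⟨f, h1, h2⟩ := exists_coordChange he he' x₀ x₁
    exact ⟨f, h1.continuousOn, h2⟩
  totalSpaceMk_isInducing _ := ⟨rfl⟩

instance (Q : PrincipalBundle E X EP P) :
    TopologicalSpace (TotalSpace (ℂ × (E →L[ℂ] ℂ)) Q.WFib) :=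
  Q.prebundle.totalSpaceTopology

instance (Q : PrincipalBundle E X EP P) : FiberBundle (ℂ × (E →L[ℂ] ℂ)) Q.WFib :=
  Q.prebundle.toFiberBundle

instance (Q : PrincipalBundle E X EP P) : VectorBundle ℂ (ℂ × (E →L[ℂ] ℂ)) Q.WFib :=
  Q.prebundle.toVectorBundle

instance (Q : PrincipalBundle E X EP P) : Q.prebundle.IsContMDiff 𝓘(ℂ, E) ω where
  exists_contMDiffCoordChange := by
    rintro _ ⟨e, he, x₀, rfl⟩ _ ⟨e', he', x₁, rfl⟩
    exact exists_coordChange he he' x₀ x₁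

/-- `W_P` is a holomorphic vector bundle. -/
instance (Q : PrincipalBundle E X EP P) :
    ContMDiffVectorBundle ω (ℂ × (E →L[ℂ] ℂ)) Q.WFib 𝓘(ℂ, E) :=
  Q.prebundle.contMDiffVectorBundle 𝓘(ℂ, E)

/-- `Z° = Tot(W_P)`. -/
abbrev Z (Q : PrincipalBundle E X EP P) : Type _ := TotalSpace (ℂ × (E →L[ℂ] ℂ)) Q.WFib

/-- The model with corners of `Z°`. -/
abbrev IZ (E : Type*) [NormedAddCommGroup E] [NormedSpace ℂ E] :
    ModelWithCorners ℂ (E × (ℂ × (E →L[ℂ] ℂ))) (ModelProd E (ℂ × (E →L[ℂ] ℂ))) :=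
  𝓘(ℂ, E).prod 𝓘(ℂ, ℂ × (E →L[ℂ] ℂ))

/-- The projection `π° = λ : Z° → ℂ`. -/
def lam (z : Q.Z) : ℂ := z.2.scalar

/-- The fibre `C_c = (π°)⁻¹(c)`, with its inclusion `incl` in `Z°`. -/
@[ext]
structure C (Q : PrincipalBundle E X EP P) (c : ℂ) : Type _ where
  incl : Q.Z
  lam_incl : lam incl = c

/-- The projection `q : C_c → X`. -/
def C.base {c : ℂ} (z : Q.C c) : X := z.incl.proj

/-- `C_c` has the subspace topology. -/
instance (c : ℂ) : TopologicalSpace (Q.C c) := .induced C.incl inferInstance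

theorem isInducing_incl (c : ℂ) : IsInducing (C.incl : Q.C c → Q.Z) := ⟨rfl⟩

/-- The chart of `Z°` around `z₀`. -/
abbrev zchart (z₀ : Q.Z) : OpenPartialHomeomorph Q.Z (ModelProd E (ℂ × (E →L[ℂ] ℂ))) :=
  chartAt (ModelProd E (ℂ × (E →L[ℂ] ℂ))) z₀

theorem zchart_scalar (z₀ z : Q.Z) : (zchart z₀ z).2.1 = lam z := by
  unfold zchart
  rw [FiberBundle.chartedSpace_chartAt]; rfl

theorem lam_symm (z₀ : Q.Z) {y : ModelProd E (ℂ × (E →L[ℂ] ℂ))} (hy : y ∈ (zchart z₀).target) :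
    lam ((zchart z₀).symm y) = y.2.1 := by
  rw [← zchart_scalar z₀, OpenPartialHomeomorph.right_inv _ hy]

/-- The inclusion of the slice with `λ = c` in the model space of `Z°`. -/
def slice (c : ℂ) (y : E × (E →L[ℂ] ℂ)) : E × (ℂ × (E →L[ℂ] ℂ)) := (y.1, (c, y.2))

/-- The projection which forgets the coordinate `λ`. -/
def forget (y : E × (ℂ × (E →L[ℂ] ℂ))) : E × (E →L[ℂ] ℂ) := (y.1, y.2.2)

theorem contDiff_slice (c : ℂ) : ContDiff ℂ ω (slice (E := E) c) :=
  contDiff_fst.prodMk (contDiff_const.prodMk contDiff_snd)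

theorem contDiff_forget : ContDiff ℂ ω (forget (E := E)) :=
  contDiff_fst.prodMk (contDiff_snd.comp contDiff_snd)

theorem slice_forget {c : ℂ} (z₀ : Q.Z) (z : Q.C c) :
    slice c (forget (zchart z₀ z.incl)) = zchart z₀ z.incl :=
  Prod.ext rfl (Prod.ext ((zchart_scalar z₀ z.incl).trans z.lam_incl).symm rfl)

open Classical in
/-- The point `z` of `Z°` as a point of `C_c` if it lies there. -/
def toC {c : ℂ} (z₀ : Q.C c) (z : Q.Z) : Q.C c := if h : lam z = c then ⟨z, h⟩ else z₀

theorem toC_incl {c : ℂ} (z₀ : Q.C c) {z : Q.Z} (h : lam z = c) : (toC z₀ z).incl = z := by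
  simp [toC, h]

/-- The chart of `C_c` obtained by restricting the chart of `Z°` around `z₀`, which has `λ` as one
of its coordinates, and forgetting that coordinate. -/
def chartC {c : ℂ} (z₀ : Q.C c) : OpenPartialHomeomorph (Q.C c) (E × (E →L[ℂ] ℂ)) where
  toFun z := forget (zchart z₀.incl z.incl)
  invFun y := toC z₀ ((zchart z₀.incl).symm (slice c y))
  source := C.incl ⁻¹' (zchart z₀.incl).source
  target := slice c ⁻¹' (zchart z₀.incl).target
  map_source' z hz := by
    have h := (zchart z₀.incl).map_source hz
    rw [← slice_forget] at h
    exact h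
  map_target' y hy := by
    rw [mem_preimage, toC_incl z₀ (lam_symm z₀.incl hy)]
    exact (zchart z₀.incl).map_target hy
  left_inv' z hz := by
    have h : (zchart z₀.incl).symm (slice c (forget (zchart z₀.incl z.incl))) = z.incl := by
      rw [slice_forget]; exact (zchart z₀.incl).left_inv hz
    refine C.ext ?_
    rw [h, toC_incl z₀ z.lam_incl]
  right_inv' y hy := by
    rw [toC_incl z₀ (lam_symm z₀.incl hy), (zchart z₀.incl).right_inv hy]; rfl
  open_source := (zchart z₀.incl).open_source.preimage (isInducing_incl c).continuous
  open_target := (zchart z₀.incl).open_target.preimage (contDiff_slice c).continuous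
  continuousOn_toFun := contDiff_forget.continuous.comp_continuousOn
    ((zchart z₀.incl).continuousOn.comp (isInducing_incl c).continuous.continuousOn fun _ hz => hz)
  continuousOn_invFun := by
    refine (isInducing_incl c).continuousOn_iff.2 ?_
    refine ((zchart z₀.incl).continuousOn_symm.comp (contDiff_slice c).continuous.continuousOn
      fun y hy => hy).congr fun y hy => ?_
    exact toC_incl z₀ (lam_symm z₀.incl hy)

theorem chartC_symm_incl {c : ℂ} (z₀ : Q.C c) {y : E × (E →L[ℂ] ℂ)} (hy : y ∈ (chartC z₀).target) :
    ((chartC z₀).symm y).incl = (zchart z₀.incl).symm (slice c y) :=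
  toC_incl z₀ (lam_symm z₀.incl hy)

instance (c : ℂ) : ChartedSpace (E × (E →L[ℂ] ℂ)) (Q.C c) where
  atlas := range chartC
  chartAt := chartC
  mem_chart_source z := mem_chart_source (ModelProd E (ℂ × (E →L[ℂ] ℂ))) z.incl
  chart_mem_atlas z := mem_range_self z

/-- `C_c` is a complex manifold. -/
instance (c : ℂ) : IsManifold 𝓘(ℂ, E × (E →L[ℂ] ℂ)) ω (Q.C c) := by
  refine isManifold_of_contDiffOn _ _ _ ?_
  rintro _ _ ⟨z₀, rfl⟩ ⟨z₁, rfl⟩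
  have hG := (contDiffGroupoid ω (IZ E)).compatible
    (chart_mem_atlas (ModelProd E (ℂ × (E →L[ℂ] ℂ))) z₀.incl)
    (chart_mem_atlas (ModelProd E (ℂ × (E →L[ℂ] ℂ))) z₁.incl)
  have h2 : ContDiffOn ℂ ω (IZ E ∘ ((zchart z₀.incl).symm ≫ₕ zchart z₁.incl) ∘ (IZ E).symm) _ :=
    (mem_groupoid_of_pregroupoid.1 hG).1
  have h5 : ∀ y ∈ ((chartC z₀).symm ≫ₕ chartC z₁).source,
      ((chartC z₀).symm y).incl = (zchart z₀.incl).symm (slice c y) := fun y hy =>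
    chartC_symm_incl z₀ hy.1
  refine ((contDiff_forget.comp_contDiffOn h2).comp ((contDiff_slice c).contDiffOn
    (s := ((chartC z₀).symm ≫ₕ chartC z₁).source)) ?_).congr_mono ?_ inter_subset_left
  · intro y hy
    have hy2 : ((chartC z₀).symm y).incl ∈ (zchart z₁.incl).source := hy.2
    rw [h5 y hy] at hy2
    exact ⟨⟨hy.1, hy2⟩, slice c y, rfl⟩
  · rintro y ⟨hy, -⟩
    change forget (zchart z₁.incl ((chartC z₀).symm y).incl) = _
    exact congrArg (fun z => forget (zchart z₁.incl z)) (h5 y hy)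

theorem contMDiff_lam : ContMDiff (IZ E) 𝓘(ℂ, ℂ) ω (lam : Q.Z → ℂ) := by
  intro z
  have h := (Bundle.contMDiffAt_totalSpace (IM := IZ E) (IB := 𝓘(ℂ, E)) (n := ω)
    (f := (id : Q.Z → Q.Z)) (x₀ := z)).1 contMDiffAt_id
  exact (contDiff_fst (𝕜 := ℂ) (n := ω) (E := ℂ) (F := E →L[ℂ] ℂ)).contMDiff.contMDiffAt.comp z h.2

theorem contMDiff_incl (c : ℂ) :
    ContMDiff 𝓘(ℂ, E × (E →L[ℂ] ℂ)) (IZ E) ω (C.incl : Q.C c → Q.Z) := by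
  intro z₀
  have h1 := contMDiffAt_extChartAt (I := 𝓘(ℂ, E × (E →L[ℂ] ℂ))) (n := ω) (x := z₀)
  have h2 := (contDiff_slice c).contMDiff.contMDiffAt.comp z₀ h1
  have hmem : slice c (chartC z₀ z₀) ∈ (zchart z₀.incl).target :=
    (chartC z₀).map_source (mem_chart_source (E × (E →L[ℂ] ℂ)) z₀)
  have h4 := (contMDiffOn_extChartAt_symm (I := IZ E) (n := ω) z₀.incl).contMDiffAt
    ((isOpen_extChartAt_target z₀.incl).mem_nhds (x := slice c (chartC z₀ z₀)) (by
      rw [extChartAt_target]; exact ⟨hmem, slice c (chartC z₀ z₀), rfl⟩))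
  refine (h4.comp z₀ h2).congr_of_eventuallyEq ?_
  filter_upwards [(chartC z₀).open_source.mem_nhds (mem_chart_source (E × (E →L[ℂ] ℂ)) z₀)]
    with z hz
  have h5 := chartC_symm_incl z₀ ((chartC z₀).map_source hz)
  rw [(chartC z₀).left_inv hz] at h5
  exact h5

/-! ### The cotangent bundle and its standard symplectic form -/

section Cotangent

variable (E X)

/-- The total space `T^*X` of `Ω_X`. -/
abbrev CotSpace : Type _ := TotalSpace (E →L[ℂ] ℂ) (Cot E X)

/-- The model with corners of `T^*X`. -/
abbrev IT : ModelWithCorners ℂ (E × (E →L[ℂ] ℂ)) (ModelProd E (E →L[ℂ] ℂ)) :=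
  𝓘(ℂ, E).prod 𝓘(ℂ, E →L[ℂ] ℂ)

/-- The tautological `1`-form of `T^*X`. -/
def tautForm : Form (IT E) (CotSpace E X) 1 :=
  Form.ofCovectors fun ξ => ContinuousLinearMap.comp (ξ.2 : TangentSpace 𝓘(ℂ, E) ξ.1 →L[ℂ] ℂ)
    (mfderiv (IT E) 𝓘(ℂ, E) (TotalSpace.proj : CotSpace E X → X) ξ)

/-- The standard holomorphic symplectic form of `T^*X`, the exterior derivative of the tautological
`1`-form. -/
def stdForm : Form (IT E) (CotSpace E X) 2 := (tautForm E X).d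

end Cotangent

/-! ### Relative `2`-forms on `Z°` -/

/-- The differential of `λ : Z° → ℂ`. -/
def dlam (z : Q.Z) : TangentSpace (IZ E) z →L[ℂ] ℂ := mfderiv (IZ E) 𝓘(ℂ, ℂ) lam z

/-- A field of alternating `2`-forms on the relative tangent spaces of `λ : Z° → ℂ`. -/
abbrev RelForm (Q : PrincipalBundle E X EP P) : Type _ :=
  ∀ z : Q.Z, (dlam z).ker [⋀^Fin 2]→L[ℂ] ℂ

/-- Holomorphic sections of `Ω²_{Z°/ℂ}`, the quotient of `Ω²_{Z°}` by the forms that vanish on the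
relative tangent spaces: the field is locally induced by holomorphic `2`-forms on `Z°`. -/
def RelForm.Holomorphic (Ω : RelForm Q) : Prop :=
  ∀ z₀ : Q.Z, ∃ U : Set Q.Z, IsOpen U ∧ z₀ ∈ U ∧ ∃ η : Form (IZ E) Q.Z 2,
    ∀ z ∈ U, η.HolomorphicAt z ∧
      ∀ v : Fin 2 → (dlam z).ker, Ω z v = η z (fun i => (v i : TangentSpace (IZ E) z))

theorem dlam_incl {c : ℂ} (z : Q.C c) (v : TangentSpace 𝓘(ℂ, E × (E →L[ℂ] ℂ)) z) :
    dlam z.incl (mfderiv 𝓘(ℂ, E × (E →L[ℂ] ℂ)) (IZ E) C.incl z v) = 0 := by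
  have h := mfderiv_comp z ((contMDiff_lam (Q := Q) z.incl).mdifferentiableAt (by simp))
    ((contMDiff_incl c z).mdifferentiableAt (by simp))
  have h2 : (lam : Q.Z → ℂ) ∘ (C.incl : Q.C c → Q.Z) = fun _ => c := funext fun z => z.lam_incl
  have h3 : (mfderiv 𝓘(ℂ, E × (E →L[ℂ] ℂ)) 𝓘(ℂ, ℂ)
    ((lam : Q.Z → ℂ) ∘ (C.incl : Q.C c → Q.Z)) z : E × (E →L[ℂ] ℂ) →L[ℂ] ℂ) = 0 := by
    rw [h2]; exact mfderiv_const
  exact (DFunLike.congr_fun h v).symm.trans (DFunLike.congr_fun h3 v)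

/-- The differential of `C_c → Z°`, which takes values in the relative tangent spaces. -/
def dincl {c : ℂ} (z : Q.C c) :
    TangentSpace 𝓘(ℂ, E × (E →L[ℂ] ℂ)) z →L[ℂ] (dlam z.incl).ker :=
  (mfderiv 𝓘(ℂ, E × (E →L[ℂ] ℂ)) (IZ E) C.incl z).codRestrict _ (dlam_incl z)

/-- The restriction of a relative form to the fibre `C_c`. -/
def RelForm.restrict (Ω : RelForm Q) (c : ℂ) : Form 𝓘(ℂ, E × (E →L[ℂ] ℂ)) (Q.C c) 2 := fun z =>
  (Ω z.incl).compContinuousLinearMap (dincl z)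

/-! ### The universal pullback `λ`-connection -/

/-- The vertical tangent vector `λ u - w(dπ u)`. -/
def vert {x : X} (w : Q.WFib x) (p : Q.Fib x) (u : EP) : EP :=
  w.scalar • u + (-1 : ℂ) • (show EP from w.val (Q.dProj p.1 u) p)

theorem val_add {x : X} (w : Q.WFib x) (v v' : E) (p : Q.Fib x) :
    w.val (v + v' : E) p = w.val v p + w.val v' p :=
  congrArg (fun u : Q.At x => u.1 p) (map_add w.1.2 v v')

theorem val_const_smul {x : X} (w : Q.WFib x) (k : ℂ) (v : E) (p : Q.Fib x) :
    w.val (k • v : E) p = k • w.val v p :=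
  congrArg (fun u : Q.At x => u.1 p) (map_smul w.1.2 k v)

theorem vert_add {x : X} (w : Q.WFib x) (p : Q.Fib x) (u u' : EP) :
    vert w p (u + u') = vert w p u + vert w p u' := by
  have h1 := map_add (Q.dProj p.1) u u'
  have h2 : (show EP from w.val (Q.dProj p.1 (u + u' : EP)) p) =
      (show EP from w.val (Q.dProj p.1 u) p) + (show EP from w.val (Q.dProj p.1 u') p) :=
    (congrArg (fun v => w.val v p) h1).trans (val_add w _ _ p)
  unfold vert
  rw [h2, smul_add, smul_add]; abel

theorem vert_const_smul {x : X} (w : Q.WFib x) (p : Q.Fib x) (k : ℂ) (u : EP) :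
    vert w p (k • u) = k • vert w p u := by
  have h1 := map_smul (Q.dProj p.1) k u
  have h2 : (show EP from w.val (Q.dProj p.1 (k • u : EP)) p) =
      k • (show EP from w.val (Q.dProj p.1 u) p) :=
    (congrArg (fun v => w.val v p) h1).trans (val_const_smul w _ _ p)
  unfold vert
  rw [h2, smul_add, smul_comm _ k u, smul_comm _ k]

theorem dProj_vert {x : X} (w : Q.WFib x) (p : Q.Fib x) (u : EP) :
    Q.dProj p.1 (vert (EP := EP) w p u) = 0 := by
  have h1 := map_add (Q.dProj p.1) (w.scalar • u : EP)
    ((-1 : ℂ) • (show EP from w.val (Q.dProj p.1 u) p) : EP)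
  have h2 := map_smul (Q.dProj p.1) w.scalar u
  have h3 := map_smul (Q.dProj p.1) (-1 : ℂ) (w.val (Q.dProj p.1 u) p)
  have h4 := w.dProj_val (Q.dProj p.1 u) p
  refine h1.trans ((congrArg₂ (fun a b : E => a + b) h2 (h3.trans (congrArg (fun a : E => (-1 : ℂ) • a) h4))).trans ?_)
  have h5 : ∀ t : E, w.scalar • t + (-1 : ℂ) • w.scalar • t = 0 := fun t => by
    rw [neg_one_smul, add_neg_cancel]
  exact h5 _

theorem exists_connForm {x : X} (w : Q.WFib x) (p : Q.Fib x) (u : EP) :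
    ∃ k : ℂ, fund (EP := EP) p.1 k = vert w p u :=
  eq_fund_of_dProj_eq_zero (dProj_vert w p u)

variable [FiniteDimensional ℂ EP]

/-- The value at `p ∈ P_x` of the `1`-form of the `λ`-connection `(At P)_x → (ad P)_x = ℂ` at `x`
that corresponds to an element `w : T_x X → (At P)_x` of `W_P` over `λ`, namely
`u ↦ λ u - w(dπ u)`; the latter is vertical, that is, in the image of `ι`. For `λ = 1` this is the
splitting of the Atiyah sequence whose kernel is the image of `w`. -/
def connForm {x : X} (w : Q.WFib x) (p : Q.Fib x) : EP →L[ℂ] ℂ :=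
  LinearMap.toContinuousLinearMap
    { toFun := fun u => (exists_connForm w p u).choose
      map_add' := fun u u' => Q.fund_injective p.1 (by
        rw [map_add, (exists_connForm w p _).choose_spec, (exists_connForm w p _).choose_spec,
          (exists_connForm w p _).choose_spec, vert_add])
      map_smul' := fun k u => Q.fund_injective p.1 (by
        rw [map_smul, (exists_connForm w p _).choose_spec, (exists_connForm w p _).choose_spec,
          vert_const_smul]; rfl) }

theorem fund_connForm {x : X} (w : Q.WFib x) (p : Q.Fib x) (u : EP) :
    fund (EP := EP) p.1 (connForm w p u) = vert w p u :=
  (exists_connForm w p u).choose_spec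

/-- `connForm` is a `λ`-connection: its composition with `ι` is multiplication by `λ`. -/
theorem connForm_fund {x : X} (w : Q.WFib x) (p : Q.Fib x) (k : ℂ) :
    connForm w p (fund p.1 k) = w.scalar * k := by
  refine Q.fund_injective p.1 ((fund_connForm w p _).trans ?_)
  have h1 : (show EP from w.val (Q.dProj p.1 (fund (EP := EP) p.1 k)) p) = 0 :=
    (congrArg (fun v => w.val v p) (Q.dProj_fund p.1 k)).trans
      (congrArg (fun u : Q.At x => u.1 p) (map_zero w.1.2))
  unfold vert
  rw [h1, smul_zero, add_zero, ← smul_eq_mul, map_smul]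

/-- `connForm` is invariant under the action of the group. -/
theorem connForm_dAct {x : X} (w : Q.WFib x) (p : Q.Fib x) (g : ℂˣ) (u : EP) :
    connForm w (g • p) (dAct g p.1 u) = connForm w p u := by
  refine Q.fund_injective (g • p).1 ((fund_connForm w (g • p) _).trans ?_)
  refine Eq.trans ?_ (fund_smul Q g p.1 _).symm
  rw [fund_connForm]
  have h1 := map_add (dAct (EP := EP) g p.1) (w.scalar • u : EP)
    ((-1 : ℂ) • (show EP from w.val (Q.dProj p.1 u) p) : EP)
  have h2 := map_smul (dAct (EP := EP) g p.1) w.scalar u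
  have h3 := map_smul (dAct (EP := EP) g p.1) (-1 : ℂ) (w.val (Q.dProj p.1 u) p)
  have h4 : w.val (Q.dProj (g • p.1) (dAct g p.1 u)) (g • p) =
      dAct g p.1 (w.val (Q.dProj p.1 u) p) :=
    (congrArg (fun v => w.val v (g • p)) (dProj_dAct g p.1 u)).trans (w.val_smul _ g p)
  refine Eq.trans ?_ (h1.trans (congrArg₂ (fun a b : EP => a + b) h2 h3)).symm
  exact congrArg (fun a : EP => w.scalar • (show EP from dAct g p.1 u) + (-1 : ℂ) • a) h4

/-- The `1`-form on `C_c` of the universal `c`-connection on `q^*P` with respect to a local section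
of `q^*P`, that is, a local lift of `q : C_c → X` to `P`: the pullback by the lift of the `1`-form
of the `c`-connection. -/
def univForm {c : ℂ} (s : ∀ z : Q.C c, Q.Fib z.base) : Form 𝓘(ℂ, E × (E →L[ℂ] ℂ)) (Q.C c) 1 :=
  Form.ofCovectors fun z => ContinuousLinearMap.comp (connForm z.incl.2 (s z))
    (mfderiv 𝓘(ℂ, E × (E →L[ℂ] ℂ)) 𝓘(ℂ, EP) (fun z : Q.C c => (s z).1) z)

/-- The element `v ↦ -ι (a v)` of `W_P`, over `λ = 0`, that corresponds to a covector `a`. -/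
def negIota (x : X) (a : E →L[ℂ] ℂ) : Q.WFib x :=
  ⟨(0,
    { toFun := fun v => ⟨fun p => fund (EP := EP) p.1 (-a v), fun g p => fund_smul Q g p.1 _⟩
      map_add' := fun v v' => Subtype.ext (funext fun p =>
        map_add ((fund (EP := EP) p.1).comp (-a)) v v')
      map_smul' := fun k v => Subtype.ext (funext fun p =>
        map_smul ((fund (EP := EP) p.1).comp (-a)) k v) }),
    fun v p => (Q.dProj_fund p.1 (-a v)).trans (zero_smul ℂ (v : E)).symm⟩

/-- The identification `T^*X = C_0`: the covector `ξ` corresponds to the `0`-connection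
`At P → Θ_X → ad P = ℂ` given by `ξ`. -/
def ofCovector (ξ : CotSpace E X) : Q.C 0 where
  incl := ⟨ξ.1, negIota ξ.1 (ofCot ξ.2)⟩
  lam_incl := rfl

theorem connForm_negIota (x : X) (a : E →L[ℂ] ℂ) (p : Q.Fib x) (u : EP) :
    connForm (negIota x a) p u = a (Q.dProj p.1 u) := by
  refine Q.fund_injective p.1 ((fund_connForm _ p u).trans ?_)
  change (0 : ℂ) • u + (-1 : ℂ) • fund (EP := EP) p.1 (-a (Q.dProj p.1 u)) = _
  rw [zero_smul, zero_add, map_neg, neg_one_smul, neg_neg]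

theorem connForm_ofCovector (ξ : CotSpace E X) (p : Q.Fib ξ.1) (u : EP) :
    connForm (ofCovector (Q := Q) ξ).incl.2 p u = ofCot ξ.2 (Q.dProj p.1 u) :=
  connForm_negIota ξ.1 (ofCot ξ.2) p u

theorem ofCovector_bijective : Function.Bijective (ofCovector : CotSpace E X → Q.C 0) := by
  constructor
  · rintro ⟨x, a⟩ ⟨x', a'⟩ h
    have h1 : (⟨x, negIota x (ofCot a)⟩ : Q.Z) = ⟨x', negIota x' (ofCot a')⟩ := congrArg C.incl h
    obtain rfl : x = x' := congrArg TotalSpace.proj h1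
    have h2 : (negIota x (ofCot a) : Q.WFib x) = negIota x (ofCot a') :=
      TotalSpace.mk_injective x h1
    refine congrArg (TotalSpace.mk x) ?_
    refine ContinuousLinearMap.ext fun v => ?_
    have h3 := congrArg (fun w : Q.WFib x => w.val v (Q.pt x)) h2
    exact neg_injective (Q.fund_injective (Q.pt x).1 h3)
  · rintro ⟨⟨x, w⟩, h0⟩
    obtain ⟨e, hx, he⟩ := Q.exists_triv x
    have h1 := ofCotan_cotan he hx w
    have h0' : w.scalar = 0 := h0
    refine ⟨⟨x, toCot x (-cotan e w)⟩, C.ext (congrArg (TotalSpace.mk x) ?_)⟩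
    refine Eq.trans ?_ h1
    rw [h0']
    refine WFib.ext_val rfl fun v p => ?_
    change fund (EP := EP) p.1 (- -cotan e w v) =
      (0 : ℂ) • lift (EP := EP) e p.1 v + fund (EP := EP) p.1 (cotan e w v)
    rw [zero_smul, zero_add, neg_neg]

end PrincipalBundle
end PrincipalBundle
end CStar

end

/-! A local trivialization `e` of `P` splits `W_P` locally as the sum of the trivial line bundle and
`Ω_X`: a point `w` has the coordinates λ and the covector `cotan e w`. Applying the logarithmic
differential `dlog e` of the fibre coordinate to λu - w(dπ u) gives s_w = λ · `dlog e` - `cotan e w`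
∘ dπ (`connForm_eq`). Pulling back along a section σ over a part of C_c, where λ is the constant c,
yields A_σ = c · dlog(coord ∘ σ) - cotan ∘ dq (`univForm_eq`). The first term is closed and is the
only one that involves σ. Hence dA_σ is the restriction to C_c of the exterior derivative of
`potential e`, the form -cotan ∘ d(pr) on Z° with pr the projection to X, whatever σ is
(`d_univForm`).

The form ω° is therefore d(`potential e`) restricted to ker dλ. Changing `e` adds to `cotan e` the
term λ · dlog g, with g the transition function, so d(`potential e`) changes by -dλ ∧ dlog g. This
vanishes on ker dλ but not on Z°, which is why ω° is only a relative form. The proof obtains the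
independence of `e` without transition functions, by comparing both sides with dA_s for a single
local section s (`restrict_relForm_eq`).

In the bundle charts `potential` becomes the Liouville form with the covector reflected
(`potential_triv_eventuallyEq`). This gives holomorphy, and it gives nondegeneracy on each C_c
because d of the Liouville form is the canonical symplectic form of E × E*. Closedness is d² = 0
applied to the local potentials. On C_0 the covector ξ has `cotan` equal to -ξ, so the potential
pulls back to the tautological form.

Forms are differentiated at each point in the chart of that point, so the calculus used above
(naturality of d, d² = 0, holomorphy of dη) has to be derived from the calculus on normed spaces. -/

noncomputable section

namespace CStar

/-! ### Analytic dependence of pullback and exterior derivative on a normed space -/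

section Alternating

variable {F F' : Type*} [NormedAddCommGroup F] [NormedSpace ℂ F]
  [NormedAddCommGroup F'] [NormedSpace ℂ F']

/-- Alternatization of continuous multilinear maps, as a continuous linear map. -/
def alternatizationCLM (F : Type*) [NormedAddCommGroup F] [NormedSpace ℂ F] (n : ℕ) :
    ContinuousMultilinearMap ℂ (fun _ : Fin n => F) ℂ →L[ℂ] F [⋀^Fin n]→L[ℂ] ℂ :=
  LinearMap.mkContinuous
    { toFun := fun f => ContinuousMultilinearMap.alternatization f
      map_add' := fun f g => map_add _ f g
      map_smul' := fun c f => by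
        ext v
        change ContinuousMultilinearMap.alternatization (c • f) v =
          c • ContinuousMultilinearMap.alternatization f v
        simp only [ContinuousMultilinearMap.alternatization_apply_apply, Finset.smul_sum,
          smul_apply, smul_comm c] }
    (Fintype.card (Equiv.Perm (Fin n))) fun f => by
      refine ContinuousAlternatingMap.opNorm_le_bound _
        (mul_nonneg (Nat.cast_nonneg _) (norm_nonneg _)) fun v => ?_
      change ‖ContinuousMultilinearMap.alternatization f v‖ ≤ _
      rw [ContinuousMultilinearMap.alternatization_apply_apply]
      refine (norm_sum_le _ _).trans ?_
      refine (Finset.sum_le_card_nsmul _ _ (‖f‖ * ∏ i, ‖v i‖) fun σ _ => ?_).trans ?_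
      · have h : ‖f (v ∘ σ)‖ ≤ ‖f‖ * ∏ i, ‖v i‖ := by
          refine (f.le_opNorm _).trans (le_of_eq ?_)
          congr 1
          exact Equiv.prod_comp σ fun i => ‖v i‖
        rcases Int.units_eq_one_or (Equiv.Perm.sign σ) with h1 | h1 <;> rw [h1] <;> simpa using h
      · rw [nsmul_eq_mul, Finset.card_univ, mul_assoc]

/-- Each permutation contributes its sign twice, once from the alternatization and once from `f`, so
all n! summands equal `f`. Hence alternatization divided by n! retracts multilinear maps onto
alternating ones. -/
theorem alternatizationCLM_coe {n : ℕ} (f : F [⋀^Fin n]→L[ℂ] ℂ) :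
    alternatizationCLM F n f.toContinuousMultilinearMap = (Nat.factorial n : ℂ) • f := by
  ext v
  change ContinuousMultilinearMap.alternatization f.toContinuousMultilinearMap v = _
  rw [ContinuousMultilinearMap.alternatization_apply_apply]
  have h (σ : Equiv.Perm (Fin n)) :
      Equiv.Perm.sign σ • f.toContinuousMultilinearMap (v ∘ σ) = f v := by
    have h1 : f.toContinuousMultilinearMap (v ∘ σ) = Equiv.Perm.sign σ • f v :=
      f.toAlternatingMap.map_perm v σ
    rw [h1, smul_smul, Int.units_mul_self, one_smul]
  rw [Finset.sum_congr rfl fun σ _ => h σ, Finset.sum_const, Finset.card_univ,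
    Fintype.card_perm, Fintype.card_fin, nsmul_eq_mul]
  rfl

/-- Analyticity is known for the pullback of multilinear maps. An alternating map is regarded as
multilinear, pulled back there, and brought back by alternatization divided by n!; all these
operations are analytic. The result makes pullbacks of holomorphic forms holomorphic. -/
theorem contDiff_compContinuousLinearMap (n : ℕ) :
    ContDiff ℂ ω (fun q : (F [⋀^Fin n]→L[ℂ] ℂ) × (F' →L[ℂ] F) =>
      q.1.compContinuousLinearMap q.2) := by
  have h1 : ContDiff ℂ ω
      (fun q : (Fin n → F' →L[ℂ] F) × ContinuousMultilinearMap ℂ (fun _ : Fin n => F) ℂ =>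
        q.2.compContinuousLinearMap q.1) :=
    contDiff_iff_contDiffAt.2 fun q =>
      ContinuousMultilinearMap.analyticAt_uncurry_compContinuousLinearMap.contDiffAt
  have h2 : ContDiff ℂ ω (fun q : (F [⋀^Fin n]→L[ℂ] ℂ) × (F' →L[ℂ] F) =>
      ((fun _ : Fin n => q.2 : Fin n → F' →L[ℂ] F),
        q.1.toContinuousMultilinearMap)) :=
    (contDiff_pi.2 fun _ => contDiff_snd).prodMk
      ((ContinuousAlternatingMap.toContinuousMultilinearMapCLM (𝕜 := ℂ) (E := F) (F := ℂ)
        (ι := Fin n) ℂ).contDiff.comp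
        contDiff_fst)
  have h3 := ((alternatizationCLM F' n).contDiff.comp (h1.comp h2)).const_smul
    ((Nat.factorial n : ℂ)⁻¹)
  convert h3 using 1
  funext q
  have h4 := alternatizationCLM_coe (q.1.compContinuousLinearMap q.2)
  change _ = (Nat.factorial n : ℂ)⁻¹ • alternatizationCLM F' n
    (q.1.compContinuousLinearMap q.2).toContinuousMultilinearMap
  rw [h4, smul_smul, inv_mul_cancel₀ (Nat.cast_ne_zero.2 (Nat.factorial_ne_zero n)), one_smul]

set_option synthInstance.maxHeartbeats 200000 in
theorem contDiffAt_extDeriv {n : ℕ} {η : F → F [⋀^Fin n]→L[ℂ] ℂ} {x : F}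
    (h : ContDiffAt ℂ ω η x) : ContDiffAt ℂ ω (extDeriv η) x := by
  have h1 : ContDiffAt ℂ ω (fderiv ℂ η) x := h.fderiv_right (m := ω) (by simp)
  have h2 : ContDiff ℂ ω (ContinuousAlternatingMap.alternatizeUncurryFinCLM ℂ F ℂ (n := n)) :=
    ContinuousLinearMap.contDiff _
  exact h2.contDiffAt.comp x h1

end Alternating

/-! ### Calculus of forms on manifolds: pullback, naturality of d, d² = 0 -/

namespace Form

variable {F : Type*} [NormedAddCommGroup F] [NormedSpace ℂ F] {H : Type*} [TopologicalSpace H]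
  {I : ModelWithCorners ℂ F H} {M : Type*} [TopologicalSpace M] [ChartedSpace H M]
  {F' : Type*} [NormedAddCommGroup F'] [NormedSpace ℂ F'] {H' : Type*} [TopologicalSpace H']
  {J : ModelWithCorners ℂ F' H'} {N : Type*} [TopologicalSpace N] [ChartedSpace H' N]
  {F'' : Type*} [NormedAddCommGroup F''] [NormedSpace ℂ F''] {H'' : Type*} [TopologicalSpace H'']
  {K : ModelWithCorners ℂ F'' H''} {O : Type*} [TopologicalSpace O] [ChartedSpace H'' O]
  {n : ℕ}

/-- The tangent space depends on the point but always unfolds to the model space. Phrasing the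
equality over the model space avoids rewriting in dependent types. -/
theorem comp_congr (η : Form I M n) {m m' : M} (h : m = m') {L L' : F' →L[ℂ] F} (hL : L = L') :
    ((η m : F [⋀^Fin n]→L[ℂ] ℂ).compContinuousLinearMap L : F' [⋀^Fin n]→L[ℂ] ℂ) =
      (η m' : F [⋀^Fin n]→L[ℂ] ℂ).compContinuousLinearMap L' := by
  subst h hL; rfl

theorem pullback_congr (η : Form I M n) {f g : N → M} {y : N} (h : f =ᶠ[𝓝 y] g) :
    (pullback (J := J) f η y : F' [⋀^Fin n]→L[ℂ] ℂ) = pullback (J := J) g η y :=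
  comp_congr (F' := F') η h.self_of_nhds h.mfderiv_eq

theorem pullback_pullback (η : Form I M n) {f : N → M} {g : O → N} {y : O}
    (hf : MDifferentiableAt J I f (g y)) (hg : MDifferentiableAt K J g y) :
    (pullback (J := K) g (pullback (J := J) f η) y : F'' [⋀^Fin n]→L[ℂ] ℂ) =
      pullback (J := K) (f ∘ g) η y := by
  refine Eq.trans ?_ (comp_congr (F' := F'') η (m := f (g y)) rfl (mfderiv_comp y hf hg)).symm
  rfl

theorem pullback_id (η : Form I M n) {f : M → M} {y : M} (h : f =ᶠ[𝓝 y] id) :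
    (pullback (J := I) f η y : F [⋀^Fin n]→L[ℂ] ℂ) = η y := by
  refine (pullback_congr η h).trans ?_
  refine (comp_congr (F' := F) η (m := y) rfl (mfderiv_id (I := I) (x := y))).trans ?_
  rfl

variable [I.Boundaryless]

/-- Seen as a pullback along the inverse chart, the chart expression obeys the functoriality
`pullback_pullback`. -/
theorem inChart_eq (η : Form I M n) (m₀ : M) :
    η.inChart m₀ = pullback (J := 𝓘(ℂ, F)) (extChartAt I m₀).symm η := by
  funext y
  unfold inChart pullback
  rw [I.range_eq_univ, mfderivWithin_univ]
  rfl

theorem holomorphicAt_iff (η : Form I M n) (m₀ : M) :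
    η.HolomorphicAt m₀ ↔ ContDiffAt ℂ ω (η.inChart m₀) (extChartAt I m₀ m₀) := by
  unfold HolomorphicAt
  rw [I.range_eq_univ, contDiffWithinAt_univ]

theorem d_eq (η : Form I M n) (m₀ : M) :
    η.d m₀ = (extDeriv (η.inChart m₀) (extChartAt I m₀ m₀)).compContinuousLinearMap
      (mfderiv I 𝓘(ℂ, F) (extChartAt I m₀) m₀) := by
  unfold d
  rw [I.range_eq_univ, extDerivWithin_univ]

theorem inChart_congr {η η' : Form I M n} {m₀ : M} (h : ∀ᶠ m in 𝓝 m₀, η m = η' m) :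
    η.inChart m₀ =ᶠ[𝓝 (extChartAt I m₀ m₀)] η'.inChart m₀ := by
  have h1 : Filter.Tendsto (extChartAt I m₀).symm (𝓝 (extChartAt I m₀ m₀)) (𝓝 m₀) := by
    have := continuousAt_extChartAt_symm (I := I) m₀
    rw [ContinuousAt, extChartAt_to_inv] at this
    exact this
  filter_upwards [h1.eventually h] with y hy
  unfold inChart
  rw [hy]

theorem HolomorphicAt.congr {η η' : Form I M n} {m₀ : M} (hη : η.HolomorphicAt m₀)
    (h : ∀ᶠ m in 𝓝 m₀, η' m = η m) : η'.HolomorphicAt m₀ := by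
  rw [holomorphicAt_iff] at hη ⊢
  exact hη.congr_of_eventuallyEq (inChart_congr h)

theorem d_congr {η η' : Form I M n} {m₀ : M} (h : ∀ᶠ m in 𝓝 m₀, η m = η' m) :
    η.d m₀ = η'.d m₀ := by
  rw [d_eq, d_eq, (inChart_congr h).extDeriv_eq]

theorem d_add {η η' : Form I M n} {m₀ : M} (h : η.HolomorphicAt m₀)
    (h' : η'.HolomorphicAt m₀) : (η + η').d m₀ = η.d m₀ + η'.d m₀ := by
  rw [holomorphicAt_iff] at h h'
  rw [d_eq, d_eq, d_eq]
  have h1 : (η + η').inChart m₀ = η.inChart m₀ + η'.inChart m₀ := rfl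
  rw [h1, extDeriv_add (h.differentiableAt (by simp)) (h'.differentiableAt (by simp))]
  rfl

theorem holomorphicAt_modelSpace (η : Form 𝓘(ℂ, F) F n) (y : F) :
    η.HolomorphicAt y ↔ ContDiffAt ℂ ω (fun z : F => (show F [⋀^Fin n]→L[ℂ] ℂ from η z)) y := by
  rw [holomorphicAt_iff, inChart_eq]
  have h : (pullback (J := 𝓘(ℂ, F)) (extChartAt 𝓘(ℂ, F) y).symm η : F → F [⋀^Fin n]→L[ℂ] ℂ) =
      fun z : F => (show F [⋀^Fin n]→L[ℂ] ℂ from η z) :=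
    funext fun z => pullback_id η (Filter.Eventually.of_forall fun _ => by
      rw [extChartAt_model_space_eq_id]; rfl)
  rw [h, extChartAt_model_space_eq_id]
  rfl

theorem d_modelSpace (η : Form 𝓘(ℂ, F) F n) (y : F) :
    (η.d y : F [⋀^Fin (n + 1)]→L[ℂ] ℂ) =
      extDeriv (fun z : F => (show F [⋀^Fin n]→L[ℂ] ℂ from η z)) y := by
  rw [d_eq, inChart_eq]
  have h : (pullback (J := 𝓘(ℂ, F)) (extChartAt 𝓘(ℂ, F) y).symm η : F → F [⋀^Fin n]→L[ℂ] ℂ) =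
      fun z : F => (show F [⋀^Fin n]→L[ℂ] ℂ from η z) :=
    funext fun z => pullback_id η (Filter.Eventually.of_forall fun _ => by
      rw [extChartAt_model_space_eq_id]; rfl)
  rw [h]
  have h2 : (mfderiv 𝓘(ℂ, F) 𝓘(ℂ, F) (extChartAt 𝓘(ℂ, F) y) y : F →L[ℂ] F) =
      ContinuousLinearMap.id ℂ F := mfderiv_extChartAt_self (I := 𝓘(ℂ, F)) (x := y)
  refine (congrArg (fun L : F →L[ℂ] F => (extDeriv (fun z : F => (show F [⋀^Fin n]→L[ℂ] ℂ from η z))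
    (extChartAt 𝓘(ℂ, F) y y)).compContinuousLinearMap L) h2).trans ?_
  simp only [extChartAt_model_space_eq_id]
  rfl

variable [J.Boundaryless] [IsManifold I ω M] [IsManifold J ω N]

theorem contMDiffAt_extChartAt_symm (m₀ : M) :
    ContMDiffAt 𝓘(ℂ, F) I ω (extChartAt I m₀).symm (extChartAt I m₀ m₀) :=
  (contMDiffOn_extChartAt_symm (I := I) (n := ω) m₀).contMDiffAt (extChartAt_target_mem_nhds m₀)

/-- The expression of a map in charts. -/
def readMap (I : ModelWithCorners ℂ F H) (J : ModelWithCorners ℂ F' H') (f : N → M) (n₀ : N) :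
    F' → F := extChartAt I (f n₀) ∘ f ∘ (extChartAt J n₀).symm

theorem contDiffAt_readMap {f : N → M} {n₀ : N} (hf : ContMDiffAt J I ω f n₀) :
    ContDiffAt ℂ ω (readMap I J f n₀) (extChartAt J n₀ n₀) := by
  rw [← contMDiffAt_iff_contDiffAt]
  have h2 := contMDiffAt_extChartAt_symm (I := J) n₀
  have e : (extChartAt J n₀).symm (extChartAt J n₀ n₀) = n₀ := extChartAt_to_inv n₀
  have h1 : ContMDiffAt J 𝓘(ℂ, F) ω (extChartAt I (f n₀) ∘ f)
      ((extChartAt J n₀).symm (extChartAt J n₀ n₀)) := by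
    rw [e]
    exact (contMDiffAt_extChartAt (I := I) (n := ω) (x := f n₀)).comp n₀ hf
  exact h1.comp _ h2

/-- Both sides are pullbacks of `η` along one map: the left along f after the inverse chart of N,
the right along the same map followed by the chart of M and its inverse. These two maps agree where
f lands in the source of the chart of M. -/
theorem inChart_pullback (η : Form I M n) {f : N → M} {n₀ : N} (hf : ContMDiffAt J I ω f n₀) :
    (pullback (J := J) f η).inChart n₀ =ᶠ[𝓝 (extChartAt J n₀ n₀)] fun y =>
      (η.inChart (f n₀) (readMap I J f n₀ y)).compContinuousLinearMap
        (fderiv ℂ (readMap I J f n₀) y) := by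
  have hψ := contMDiffAt_extChartAt_symm (I := J) n₀
  have e : (extChartAt J n₀).symm (extChartAt J n₀ n₀) = n₀ := extChartAt_to_inv n₀
  have c1 : Filter.Tendsto (extChartAt J n₀).symm (𝓝 (extChartAt J n₀ n₀)) (𝓝 n₀) := by
    have := hψ.continuousAt
    rwa [ContinuousAt, e] at this
  have c2 : Filter.Tendsto (readMap I J f n₀) (𝓝 (extChartAt J n₀ n₀))
      (𝓝 (extChartAt I (f n₀) (f n₀))) := by
    have := (contDiffAt_readMap hf).continuousAt
    rw [ContinuousAt] at this
    simpa [readMap] using this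
  have hsrc : ∀ᶠ y in 𝓝 (extChartAt J n₀ n₀),
      f ((extChartAt J n₀).symm y) ∈ (extChartAt I (f n₀)).source :=
    (hf.continuousAt.tendsto.comp c1).eventually (extChartAt_source_mem_nhds (f n₀))
  -- The chain rule is needed at all nearby points, and analyticity at a point spreads to a
  -- neighbourhood.
  filter_upwards [c1.eventually ((contMDiffAt_iff_contMDiffAt_nhds (by simp)).1 hf),
    (contMDiffAt_iff_contMDiffAt_nhds (by simp)).1 hψ,
    c2.eventually ((contMDiffAt_iff_contMDiffAt_nhds (by simp)).1
      (contMDiffAt_extChartAt_symm (I := I) (f n₀))),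
    (contMDiffAt_iff_contMDiffAt_nhds (by simp)).1 (contDiffAt_readMap hf).contMDiffAt,
    hsrc.eventually_nhds] with y h1 h2 h3 h4 h5
  rw [inChart_eq, inChart_eq]
  have a1 := pullback_pullback η (h1.mdifferentiableAt (by simp)) (h2.mdifferentiableAt (by simp))
  have a2 := pullback_pullback η (h3.mdifferentiableAt (by simp)) (h4.mdifferentiableAt (by simp))
  refine a1.trans ((pullback_congr η ?_).trans (a2.symm.trans ?_))
  · filter_upwards [h5] with z hz
    exact ((extChartAt I (f n₀)).left_inv hz).symm
  · refine comp_congr (F' := F') (pullback (J := 𝓘(ℂ, F)) (extChartAt I (f n₀)).symm η) rfl ?_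
    exact mfderiv_eq_fderiv

theorem HolomorphicAt.pullback {η : Form I M n} {f : N → M} {n₀ : N}
    (hη : η.HolomorphicAt (f n₀)) (hf : ContMDiffAt J I ω f n₀) :
    (Form.pullback (J := J) f η).HolomorphicAt n₀ := by
  rw [holomorphicAt_iff] at hη ⊢
  refine ContDiffAt.congr_of_eventuallyEq ?_ (inChart_pullback η hf)
  have hG := contDiffAt_readMap hf
  have e : readMap I J f n₀ (extChartAt J n₀ n₀) = extChartAt I (f n₀) (f n₀) := by
    simp [readMap]
  have h1 : ContDiffAt ℂ ω (η.inChart (f n₀)) (readMap I J f n₀ (extChartAt J n₀ n₀)) := by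
    rwa [e]
  exact (contDiff_compContinuousLinearMap n).contDiffAt.comp _
    ((h1.comp _ hG).prodMk (hG.fderiv_right (m := ω) (by simp)))

/-- In charts this is the naturality of `extDeriv` on normed spaces. What remains is the chain rule
`h5`, which moves the differential of the chart past that of f. -/
theorem d_pullback {η : Form I M n} {f : N → M} {n₀ : N}
    (hη : η.HolomorphicAt (f n₀)) (hf : ContMDiffAt J I ω f n₀) :
    (Form.pullback (J := J) f η).d n₀ = Form.pullback (J := J) f η.d n₀ := by
  rw [holomorphicAt_iff] at hη
  have hG := contDiffAt_readMap hf
  have e : readMap I J f n₀ (extChartAt J n₀ n₀) = extChartAt I (f n₀) (f n₀) := by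
    simp [readMap]
  rw [d_eq, (inChart_pullback η hf).extDeriv_eq,
    extDeriv_pullback (by rw [e]; exact hη.differentiableAt (by simp)) hG (by simp), e]
  have hψ := mdifferentiableAt_extChartAt (I := J) (mem_chart_source H' n₀)
  have hφ := mdifferentiableAt_extChartAt (I := I) (mem_chart_source H (f n₀))
  have h1 := mfderiv_comp n₀ hφ (hf.mdifferentiableAt (by simp))
  have h2 : MDifferentiableAt 𝓘(ℂ, F') 𝓘(ℂ, F) (readMap I J f n₀) (extChartAt J n₀ n₀) :=
    (hG.differentiableAt (by simp)).mdifferentiableAt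
  have h3 := mfderiv_comp n₀ h2 hψ
  have h4 : readMap I J f n₀ ∘ extChartAt J n₀ =ᶠ[𝓝 n₀] extChartAt I (f n₀) ∘ f := by
    filter_upwards [extChartAt_source_mem_nhds (I := J) n₀] with z hz
    change extChartAt I (f n₀) (f ((extChartAt J n₀).symm (extChartAt J n₀ z))) = _
    rw [(extChartAt J n₀).left_inv hz]; rfl
  have h5 : (fderiv ℂ (readMap I J f n₀) (extChartAt J n₀ n₀)) ∘L
      (mfderiv J 𝓘(ℂ, F') (extChartAt J n₀) n₀ : F' →L[ℂ] F') =
      (mfderiv I 𝓘(ℂ, F) (extChartAt I (f n₀)) (f n₀) : F →L[ℂ] F) ∘L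
        (mfderiv J I f n₀ : F' →L[ℂ] F) := by
    rw [← mfderiv_eq_fderiv]
    exact (h3.symm.trans h4.mfderiv_eq).trans h1
  unfold Form.pullback
  rw [d_eq]
  exact congrArg (fun L : F' →L[ℂ] F => (extDeriv (η.inChart (f n₀))
    (extChartAt I (f n₀) (f n₀))).compContinuousLinearMap L) h5

/-- The chart expression of `η` around `m₀`, as a form on the model space. -/
def chartForm (η : Form I M n) (m₀ : M) : Form 𝓘(ℂ, F) F n := η.inChart m₀

/-- Since `d` uses a different chart at every point, properties of η.d near m₀ are not visible from
its definition. Writing η near m₀ as the pullback of a single form on the model space lets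
`d_pullback` compute η.d on a whole neighbourhood. -/
theorem eventually_eq_pullback_chartForm (η : Form I M n) (m₀ : M) :
    ∀ᶠ m in 𝓝 m₀, η m = Form.pullback (J := I) (extChartAt I m₀) (η.chartForm m₀) m := by
  filter_upwards [(extChartAt_source_mem_nhds (I := I) m₀),
    (eventually_mem_nhds_iff.2 (extChartAt_source_mem_nhds (I := I) m₀))] with m hm hm'
  have h1 : MDifferentiableAt I 𝓘(ℂ, F) (extChartAt I m₀) m :=
    mdifferentiableAt_extChartAt (by rwa [extChartAt_source] at hm)
  have h2 : MDifferentiableAt 𝓘(ℂ, F) I (extChartAt I m₀).symm (extChartAt I m₀ m) :=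
    ((contMDiffOn_extChartAt_symm (I := I) (n := ω) m₀).contMDiffAt
      ((isOpen_extChartAt_target m₀).mem_nhds
        ((extChartAt I m₀).map_source hm))).mdifferentiableAt (by simp)
  have h3 : η.chartForm m₀ = Form.pullback (J := 𝓘(ℂ, F)) (extChartAt I m₀).symm η := inChart_eq η m₀
  rw [h3]
  refine (pullback_id η ?_).symm.trans (pullback_pullback η h2 h1).symm
  filter_upwards [hm'] with z hz using (extChartAt I m₀).left_inv hz

theorem HolomorphicAt.eventually {η : Form I M n} {m₀ : M} (h : η.HolomorphicAt m₀) :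
    ∀ᶠ m in 𝓝 m₀, η.HolomorphicAt m := by
  have h1 : ∀ᶠ y in 𝓝 (extChartAt I m₀ m₀), (η.chartForm m₀).HolomorphicAt y := by
    simp only [holomorphicAt_modelSpace]
    exact ((holomorphicAt_iff η m₀).1 h).eventually (by simp)
  filter_upwards [(continuousAt_extChartAt (I := I) m₀).eventually h1,
    (eventually_eq_pullback_chartForm η m₀).eventually_nhds,
    extChartAt_source_mem_nhds (I := I) m₀] with m h2 h3 h4
  exact (h2.pullback (contMDiffAt_extChartAt' (by rwa [extChartAt_source] at h4))).congr h3

/-- This expresses `d` on a neighbourhood through one chart. Holomorphy of η.d and d² = 0 then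
follow from the corresponding facts on the model space. -/
theorem HolomorphicAt.eventually_d {η : Form I M n} {m₀ : M} (h : η.HolomorphicAt m₀) :
    ∀ᶠ m in 𝓝 m₀, η.d m = Form.pullback (J := I) (extChartAt I m₀) (η.chartForm m₀).d m := by
  have h1 : ∀ᶠ y in 𝓝 (extChartAt I m₀ m₀), (η.chartForm m₀).HolomorphicAt y := by
    simp only [holomorphicAt_modelSpace]
    exact ((holomorphicAt_iff η m₀).1 h).eventually (by simp)
  filter_upwards [(continuousAt_extChartAt (I := I) m₀).eventually h1,
    (eventually_eq_pullback_chartForm η m₀).eventually_nhds,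
    extChartAt_source_mem_nhds (I := I) m₀] with m h2 h3 h4
  exact (d_congr h3).trans
    (d_pullback h2 (contMDiffAt_extChartAt' (by rwa [extChartAt_source] at h4)))

theorem HolomorphicAt.d {η : Form I M n} {m₀ : M} (h : η.HolomorphicAt m₀) :
    η.d.HolomorphicAt m₀ := by
  refine HolomorphicAt.congr
    (η := Form.pullback (J := I) (extChartAt I m₀) (η.chartForm m₀).d) ?_ h.eventually_d
  refine HolomorphicAt.pullback ?_ contMDiffAt_extChartAt
  rw [holomorphicAt_modelSpace]
  simp only [d_modelSpace]
  exact contDiffAt_extDeriv ((holomorphicAt_iff η m₀).1 h)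

theorem HolomorphicAt.d_d {η : Form I M n} {m₀ : M} (h : η.HolomorphicAt m₀) :
    η.d.d m₀ = 0 := by
  have h1 : (η.chartForm m₀).HolomorphicAt (extChartAt I m₀ m₀) :=
    (holomorphicAt_modelSpace _ _).2 ((holomorphicAt_iff η m₀).1 h)
  rw [d_congr h.eventually_d, d_pullback h1.d contMDiffAt_extChartAt]
  have h2 : ((η.chartForm m₀).d.d (extChartAt I m₀ m₀) : F [⋀^Fin (n + 1 + 1)]→L[ℂ] ℂ) = 0 := by
    rw [d_modelSpace]
    simp only [d_modelSpace]
    exact extDeriv_extDeriv_apply ((holomorphicAt_iff η m₀).1 h) (by simp)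
  exact congrArg (fun L : F [⋀^Fin (n + 1 + 1)]→L[ℂ] ℂ => L.compContinuousLinearMap
    (mfderiv I 𝓘(ℂ, F) (extChartAt I m₀) m₀ : F →L[ℂ] F)) h2

end Form

/-! ### Two model forms: c dy/y on ℂ and the Liouville form on E × E* -/

namespace Form

variable {F : Type*} [NormedAddCommGroup F] [NormedSpace ℂ F] {H : Type*} [TopologicalSpace H]
  {I : ModelWithCorners ℂ F H} {M : Type*} [TopologicalSpace M] [ChartedSpace H M]

theorem ofCovectors_congr {θ θ' : ∀ m : M, TangentSpace I m →L[ℂ] ℂ} {m : M}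
    (h : ∀ v : F, θ m v = θ' m v) : ofCovectors θ m = ofCovectors θ' m :=
  congrArg (ContinuousAlternatingMap.ofSubsingleton ℂ (TangentSpace I m) ℂ (0 : Fin 1))
    (ContinuousLinearMap.ext h)

/-- The holomorphic `1`-form `c y⁻¹ dy` on `ℂ \ {0}`. -/
def dlogForm (c : ℂ) : Form 𝓘(ℂ, ℂ) ℂ 1 := ofCovectors fun y : ℂ =>
  ((c * y⁻¹) • ContinuousLinearMap.id ℂ ℂ : ℂ →L[ℂ] ℂ)

theorem holomorphicAt_dlogForm (c : ℂ) {y : ℂ} (hy : y ≠ 0) : (dlogForm c).HolomorphicAt y := by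
  rw [holomorphicAt_modelSpace]
  have h : ContDiffAt ℂ ω (fun y : ℂ => (c * y⁻¹) • ContinuousLinearMap.id ℂ ℂ) y :=
    (contDiffAt_const.mul (contDiffAt_inv ℂ hy)).smul contDiffAt_const
  exact (ContinuousAlternatingMap.ofSubsingletonLIE (𝕜 := ℂ) (E := ℂ) (F := ℂ)
    (0 : Fin 1)).contDiff.contDiffAt.comp y h

/-- Two vectors of a line are linearly dependent. This makes c dy/y closed without any
differentiation. -/
theorem two_form_complex_eq_zero (η : ℂ [⋀^Fin 2]→L[ℂ] ℂ) : η = 0 := by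
  refine ContinuousAlternatingMap.ext fun v => ?_
  refine η.toAlternatingMap.map_linearDependent v fun h => ?_
  have := h.fintype_card_le_finrank
  simp at this

theorem holomorphicAt_pullback_dlogForm [I.Boundaryless] [IsManifold I ω M] (c : ℂ) {h : M → ℂ}
    {m : M} (hh : ContMDiffAt I 𝓘(ℂ, ℂ) ω h m) (hm : h m ≠ 0) :
    (pullback (J := I) h (dlogForm c)).HolomorphicAt m :=
  (holomorphicAt_dlogForm c hm).pullback hh

/-- Here c is a constant. For the function λ in its place a term dλ ∧ dlog h would appear, so the
lemma serves on the fibres C_c and not on Z°. -/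
theorem d_pullback_dlogForm [I.Boundaryless] [IsManifold I ω M] (c : ℂ) {h : M → ℂ} {m : M}
    (hh : ContMDiffAt I 𝓘(ℂ, ℂ) ω h m) (hm : h m ≠ 0) :
    (pullback (J := I) h (dlogForm c)).d m = 0 := by
  rw [d_pullback (holomorphicAt_dlogForm c hm) hh]
  exact congrArg (fun L : ℂ [⋀^Fin 2]→L[ℂ] ℂ => L.compContinuousLinearMap
    (mfderiv I 𝓘(ℂ, ℂ) h m : F →L[ℂ] ℂ)) (two_form_complex_eq_zero ((dlogForm c).d (h m)))

section Liouville

variable {E : Type*} [NormedAddCommGroup E] [NormedSpace ℂ E]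

variable (E) in
/-- The Liouville form on `E × E*`. -/
def liouville : Form 𝓘(ℂ, E × (E →L[ℂ] ℂ)) (E × (E →L[ℂ] ℂ)) 1 :=
  ofCovectors fun y : E × (E →L[ℂ] ℂ) => (y.2 ∘L ContinuousLinearMap.fst ℂ E (E →L[ℂ] ℂ))

theorem contDiff_liouville : ContDiff ℂ ω fun y : E × (E →L[ℂ] ℂ) =>
    (show (E × (E →L[ℂ] ℂ)) [⋀^Fin 1]→L[ℂ] ℂ from liouville E y) := by
  have h1 : ContDiff ℂ ω fun y : E × (E →L[ℂ] ℂ) =>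
      y.2 ∘L ContinuousLinearMap.fst ℂ E (E →L[ℂ] ℂ) := contDiff_snd.clm_comp contDiff_const
  have h2 : ContDiff ℂ ω (ContinuousAlternatingMap.ofSubsingletonLIE (𝕜 := ℂ)
      (E := E × (E →L[ℂ] ℂ)) (F := ℂ) (0 : Fin 1)) := LinearIsometryEquiv.contDiff _
  exact h2.comp h1

theorem holomorphicAt_liouville (y : E × (E →L[ℂ] ℂ)) : (liouville E).HolomorphicAt y :=
  (holomorphicAt_modelSpace _ _).2 contDiff_liouville.contDiffAt

/-- The Liouville form is linear in the point: its derivative in the direction u', evaluated on u,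
is u'.2 u.1. Antisymmetrizing gives the two terms. -/
theorem d_liouville (y v w : E × (E →L[ℂ] ℂ)) :
    (show (E × (E →L[ℂ] ℂ)) [⋀^Fin 2]→L[ℂ] ℂ from (liouville E).d y) ![v, w] =
      v.2 w.1 - w.2 v.1 := by
  have h := d_modelSpace (liouville E) y
  have hd (u u' : E × (E →L[ℂ] ℂ)) :
      fderiv ℂ (fun y : E × (E →L[ℂ] ℂ) => y.2 u.1) y u' = u'.2 u.1 := by
    have h1 : HasFDerivAt (fun y : E × (E →L[ℂ] ℂ) => y.2 u.1)
        ((ContinuousLinearMap.apply ℂ ℂ u.1) ∘L ContinuousLinearMap.snd ℂ E (E →L[ℂ] ℂ)) y :=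
      ((ContinuousLinearMap.apply ℂ ℂ u.1) ∘L
        ContinuousLinearMap.snd ℂ E (E →L[ℂ] ℂ)).hasFDerivAt
    rw [h1.fderiv]; rfl
  refine (congrArg (fun L : (E × (E →L[ℂ] ℂ)) [⋀^Fin 2]→L[ℂ] ℂ => L ![v, w]) h).trans ?_
  rw [extDeriv_apply (contDiff_liouville.differentiable (by simp) y), Fin.sum_univ_two]
  have h0 := hd w v
  have h1 := hd v w
  simp only [Fin.val_zero, pow_zero, one_smul, Fin.val_one, pow_one, neg_smul]
  exact (congrArg₂ (fun a b : ℂ => a + -b) h0 h1).trans (sub_eq_add_neg _ _).symm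

/-- Testing against (0, f) shows that every functional f kills v.1, and testing against (w, 0) shows
that v.2 kills every w. -/
theorem eq_zero_of_d_liouville (y v : E × (E →L[ℂ] ℂ))
    (h : ∀ w : E × (E →L[ℂ] ℂ),
      (show (E × (E →L[ℂ] ℂ)) [⋀^Fin 2]→L[ℂ] ℂ from (liouville E).d y) ![v, w] = 0) : v = 0 := by
  simp only [d_liouville] at h
  refine Prod.ext ?_ ?_
  · refine (SeparatingDual.eq_zero_iff_forall_dual_eq_zero (R := ℂ) v.1).2 fun f => ?_
    simpa using h (0, f)
  · ext w
    simpa using h (w, 0)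

end Liouville

end Form

/-! ### The Liouville form in the standard trivializations of Ω_X -/

namespace PrincipalBundle

variable {E : Type*} [NormedAddCommGroup E] [NormedSpace ℂ E]
  {X : Type*} [TopologicalSpace X] [ChartedSpace E X] [IsManifold 𝓘(ℂ, E) ω X]

/-- The trivialization of Ω_X composes a covector with the inverse of the tangent trivialization,
and the latter is the differential of the chart. The pairing of covectors with vectors is thus
preserved. -/
theorem cotTriv_apply_mfderiv_extChartAt {x₀ x : X} (hx : x ∈ (chartAt E x₀).source)
    (a : E →L[ℂ] ℂ) (v : E) :
    (cotTriv E x₀ ⟨x, toCot x a⟩).2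
      ((mfderiv 𝓘(ℂ, E) 𝓘(ℂ, E) (extChartAt 𝓘(ℂ, E) x₀) x : E →L[ℂ] E) v) = a v := by
  have h1 := TangentBundle.continuousLinearMapAt_trivializationAt (I := 𝓘(ℂ, E)) hx
  have h2 := Bundle.Trivial.continuousLinearMapAt_trivialization ℂ X ℂ x
  have hb : x ∈ (trivializationAt E (TangentSpace 𝓘(ℂ, E)) x₀).baseSet := hx
  have h3 := (trivializationAt E (TangentSpace 𝓘(ℂ, E)) x₀).symmL_continuousLinearMapAt
    (R := ℂ) hb v
  rw [h1] at h3
  have h4 := DFunLike.congr_fun h2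
    (a ((trivializationAt E (TangentSpace 𝓘(ℂ, E)) x₀).symmL ℂ x
      ((mfderiv 𝓘(ℂ, E) 𝓘(ℂ, E) (extChartAt 𝓘(ℂ, E) x₀) x : E →L[ℂ] E) v)))
  exact h4.trans (congrArg a h3)

/-- The `1`-form `a ∘ d pr`, where `a` is a covector along `pr`, is the pullback of the Liouville
form by coordinates that read `a` in the standard trivialization of `Ω_X`. -/
theorem pullback_liouville {F : Type*} [NormedAddCommGroup F] [NormedSpace ℂ F]
    {H : Type*} [TopologicalSpace H] {I : ModelWithCorners ℂ F H}
    {M : Type*} [TopologicalSpace M] [ChartedSpace H M] {pr : M → X} {m : M} {x₀ : X}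
    {g : M → E × (E →L[ℂ] ℂ)} (a : M → E →L[ℂ] ℂ)
    (hpr : MDifferentiableAt I 𝓘(ℂ, E) pr m)
    (hg : MDifferentiableAt I 𝓘(ℂ, E × (E →L[ℂ] ℂ)) g m)
    (hx : pr m ∈ (chartAt E x₀).source)
    (hfst : (fun m => (g m).1) =ᶠ[𝓝 m] fun m => extChartAt 𝓘(ℂ, E) x₀ (pr m))
    (hsnd : (g m).2 = (cotTriv E x₀ ⟨pr m, toCot (pr m) (a m)⟩).2) :
    Form.pullback (J := I) g (Form.liouville E) m =
      Form.ofCovectors (I := I) (fun m =>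
        ((a m) ∘L (mfderiv I 𝓘(ℂ, E) pr m : F →L[ℂ] E) : F →L[ℂ] ℂ)) m := by
  have hext := mdifferentiableAt_extChartAt (I := 𝓘(ℂ, E)) hx
  have h1 := mfderiv_comp m hext hpr
  have hf : MDifferentiableAt 𝓘(ℂ, E × (E →L[ℂ] ℂ)) 𝓘(ℂ, E) Prod.fst (g m) :=
    differentiableAt_fst.mdifferentiableAt
  have h2 := mfderiv_comp m hf hg
  have h3 : (mfderiv I 𝓘(ℂ, E) (Prod.fst ∘ g) m : F →L[ℂ] E) =
      mfderiv I 𝓘(ℂ, E) (extChartAt 𝓘(ℂ, E) x₀ ∘ pr) m := hfst.mfderiv_eq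
  rw [mfderiv_eq_fderiv, fderiv_fst] at h2
  -- The Liouville form sees only the base component of dg, which is the chart differential of
  -- d(pr). This is why the second component of g need only be known at m itself.
  have h4 (v : F) : ((mfderiv I 𝓘(ℂ, E × (E →L[ℂ] ℂ)) g m : F →L[ℂ] E × (E →L[ℂ] ℂ)) v).1 =
      (mfderiv 𝓘(ℂ, E) 𝓘(ℂ, E) (extChartAt 𝓘(ℂ, E) x₀) (pr m) : E →L[ℂ] E)
        ((mfderiv I 𝓘(ℂ, E) pr m : F →L[ℂ] E) v) :=
    (DFunLike.congr_fun h2 v).symm.trans ((DFunLike.congr_fun h3 v).trans (DFunLike.congr_fun h1 v))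
  refine Form.ofCovectors_congr (I := I)
    (θ := fun m => ((g m).2 ∘L (ContinuousLinearMap.fst ℂ E (E →L[ℂ] ℂ)) ∘L
      (mfderiv I 𝓘(ℂ, E × (E →L[ℂ] ℂ)) g m : F →L[ℂ] E × (E →L[ℂ] ℂ)) : F →L[ℂ] ℂ)) fun v => ?_
  change (g m).2 ((mfderiv I 𝓘(ℂ, E × (E →L[ℂ] ℂ)) g m : F →L[ℂ] E × (E →L[ℂ] ℂ)) v).1 = _
  rw [h4, hsnd]
  exact cotTriv_apply_mfderiv_extChartAt hx (a m) _

theorem eventually_mem_chartAt_source {M : Type*} [TopologicalSpace M] {pr : M → X} {m₀ : M}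
    (h : ContinuousAt pr m₀) : ∀ᶠ m in 𝓝 m₀, pr m ∈ (chartAt E (pr m₀)).source :=
  h.eventually (chart_source_mem_nhds E (pr m₀))

end PrincipalBundle

/-! ### The potentials on Z°, the relative form and its nondegeneracy -/

namespace PrincipalBundle

variable {E : Type*} [NormedAddCommGroup E] [NormedSpace ℂ E]
  {X : Type*} [TopologicalSpace X] [ChartedSpace E X]
  {EP : Type*} [NormedAddCommGroup EP] [NormedSpace ℂ EP]
  {P : Type*} [TopologicalSpace P] [ChartedSpace EP P] [MulAction ℂˣ P]
  {Q : PrincipalBundle E X EP P} [FiniteDimensional ℂ E] [IsManifold 𝓘(ℂ, E) ω X]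

/-- The chart around z₀ is built from the chosen trivialization `Q.triv z₀.proj`. Its last
coordinate is therefore the covector that occurs in the potential of this trivialization. -/
theorem extChartAt_Z (z₀ z : Q.Z) :
    extChartAt (IZ E) z₀ z = (extChartAt 𝓘(ℂ, E) z₀.proj z.proj, (lam z,
      (cotTriv E z₀.proj ⟨z.proj, toCot z.proj (cotan (Q.triv z₀.proj) z.2)⟩).2)) := by
  rw [FiberBundle.extChartAt]; rfl

/-- The reflection of the fibres of `E × E*`. -/
def reflect (E : Type*) [NormedAddCommGroup E] [NormedSpace ℂ E] :
    (E × (E →L[ℂ] ℂ)) ≃L[ℂ] (E × (E →L[ℂ] ℂ)) :=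
  (ContinuousLinearEquiv.refl ℂ E).prodCongr (ContinuousLinearEquiv.neg ℂ)

/-- The `1`-form on `Z°` that restricts on each `C_c` to the form of the universal `c`-connection
with respect to the local section `1` of the local trivialization `e`. -/
def potential (e : Trivialization ℂˣ Q.proj) : Form (IZ E) Q.Z 1 :=
  Form.ofCovectors fun z => ((-cotan e z.2) ∘L
    (mfderiv (IZ E) 𝓘(ℂ, E) (TotalSpace.proj : Q.Z → X) z : E × (ℂ × (E →L[ℂ] ℂ)) →L[ℂ] E) :
      E × (ℂ × (E →L[ℂ] ℂ)) →L[ℂ] ℂ)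

theorem contMDiffAt_Z_proj (z : Q.Z) :
    ContMDiffAt (IZ E) 𝓘(ℂ, E) ω (TotalSpace.proj : Q.Z → X) z := Bundle.contMDiffAt_proj _

theorem contDiff_reflect_forget : ContDiff ℂ ω (reflect E ∘ forget) :=
  (reflect E).contDiff.comp contDiff_forget

/-- An instance of `pullback_liouville` with the covector -cotan; the minus sign is the source of
`reflect`. It is limited to the trivialization from which the chart at z₀ is made. -/
theorem potential_triv_eventuallyEq (z₀ : Q.Z) :
    ∀ᶠ z in 𝓝 z₀, potential (Q.triv z₀.proj) z = Form.pullback (J := IZ E)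
      ((reflect E ∘ forget) ∘ extChartAt (IZ E) z₀) (Form.liouville E) z := by
  have h1 := eventually_mem_chartAt_source (E := E) (contMDiffAt_Z_proj z₀).continuousAt
  filter_upwards [h1, chart_source_mem_nhds (ModelProd E (ℂ × (E →L[ℂ] ℂ))) z₀] with z h2 h4
  refine (pullback_liouville (I := IZ E) (pr := (TotalSpace.proj : Q.Z → X))
    (fun z => -cotan (Q.triv z₀.proj) z.2) ((contMDiffAt_Z_proj z).mdifferentiableAt (by simp))
    (((contDiff_reflect_forget.differentiable (by simp) _).mdifferentiableAt).comp z
      (mdifferentiableAt_extChartAt h4)) h2 (Filter.Eventually.of_forall fun ζ => ?_) ?_).symm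
  · exact congrArg Prod.fst (extChartAt_Z z₀ ζ)
  · have hb : z.proj ∈ (cotTriv E z₀.proj).baseSet := ⟨h2, trivial⟩
    have h5 := ((cotTriv E z₀.proj).linear ℂ hb).map_neg
      (toCot z.proj (cotan (Q.triv z₀.proj) z.2))
    refine Eq.trans ?_ h5.symm
    exact congrArg (fun y => -y.2.2) (extChartAt_Z z₀ z)

theorem holomorphicAt_potential_triv (z₀ : Q.Z) :
    (potential (Q.triv z₀.proj)).HolomorphicAt z₀ :=
  ((Form.holomorphicAt_liouville _).pullback
    (contDiff_reflect_forget.contMDiff.contMDiffAt.comp z₀ contMDiffAt_extChartAt)).congr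
      (potential_triv_eventuallyEq z₀)

/-- The relative `2`-form `ω°`. -/
def relForm (Q : PrincipalBundle E X EP P) : RelForm Q := fun z =>
  ((potential (Q.triv z.proj)).d z).compContinuousLinearMap (dlam z).ker.subtypeL

theorem restrict_relForm {c : ℂ} (z : Q.C c) :
    (relForm Q).restrict c z = (Form.pullback (J := 𝓘(ℂ, E × (E →L[ℂ] ℂ))) C.incl
      (potential (Q.triv z.base))).d z := by
  refine Eq.trans ?_
    (Form.d_pullback (holomorphicAt_potential_triv z.incl) (contMDiff_incl c z)).symm
  rfl

/-- The chart of C_c is the chart of Z° with λ forgotten, and the Liouville expression of the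
potential does not use λ. Hence C_c carries the Liouville form in all of its coordinates, with
nothing left over. -/
theorem pullback_incl_potential_eventuallyEq {c : ℂ} (z₀ : Q.C c) :
    ∀ᶠ z in 𝓝 z₀, Form.pullback (J := 𝓘(ℂ, E × (E →L[ℂ] ℂ))) C.incl
      (potential (Q.triv z₀.base)) z = Form.pullback (J := 𝓘(ℂ, E × (E →L[ℂ] ℂ)))
        (reflect E ∘ extChartAt 𝓘(ℂ, E × (E →L[ℂ] ℂ)) z₀) (Form.liouville E) z := by
  have h1 := (contMDiff_incl c z₀).continuousAt.eventually (potential_triv_eventuallyEq z₀.incl)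
  have h2 := (contMDiff_incl c z₀).continuousAt.eventually
    (chart_source_mem_nhds (ModelProd E (ℂ × (E →L[ℂ] ℂ))) z₀.incl)
  filter_upwards [h1, h2] with z h3 h4
  have h5 : MDifferentiableAt (IZ E) 𝓘(ℂ, E × (E →L[ℂ] ℂ))
      ((reflect E ∘ forget) ∘ extChartAt (IZ E) z₀.incl) z.incl :=
    ((contDiff_reflect_forget.differentiable (by simp) _).mdifferentiableAt).comp z.incl
      (mdifferentiableAt_extChartAt h4)
  refine Eq.trans ?_ (Form.pullback_pullback (Form.liouville E)
    (f := (reflect E ∘ forget) ∘ extChartAt (IZ E) z₀.incl) (g := C.incl) h5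
    ((contMDiff_incl c z).mdifferentiableAt (by simp)))
  exact congrArg (fun L : (E × (ℂ × (E →L[ℂ] ℂ))) [⋀^Fin 1]→L[ℂ] ℂ => L.compContinuousLinearMap
    (mfderiv 𝓘(ℂ, E × (E →L[ℂ] ℂ)) (IZ E) C.incl z :
      E × (E →L[ℂ] ℂ) →L[ℂ] E × (ℂ × (E →L[ℂ] ℂ)))) h3

theorem nondegenerate_restrict_relForm {c : ℂ} (z : Q.C c)
    (v : TangentSpace 𝓘(ℂ, E × (E →L[ℂ] ℂ)) z)
    (h : ∀ w : TangentSpace 𝓘(ℂ, E × (E →L[ℂ] ℂ)) z, (relForm Q).restrict c z ![v, w] = 0) :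
    v = 0 := by
  have hr : ContMDiffAt 𝓘(ℂ, E × (E →L[ℂ] ℂ)) 𝓘(ℂ, E × (E →L[ℂ] ℂ)) ω (reflect E)
      (extChartAt 𝓘(ℂ, E × (E →L[ℂ] ℂ)) z z) := (reflect E).contDiff.contMDiff.contMDiffAt
  rw [restrict_relForm, Form.d_congr (pullback_incl_potential_eventuallyEq z),
    Form.d_pullback (Form.holomorphicAt_liouville _) (hr.comp z contMDiffAt_extChartAt)] at h
  -- At its own centre a chart has the identity as differential, so only the linear isomorphism
  -- `reflect` remains.
  have h1 : (mfderiv 𝓘(ℂ, E × (E →L[ℂ] ℂ)) 𝓘(ℂ, E × (E →L[ℂ] ℂ))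
      (reflect E ∘ extChartAt 𝓘(ℂ, E × (E →L[ℂ] ℂ)) z) z :
        E × (E →L[ℂ] ℂ) →L[ℂ] E × (E →L[ℂ] ℂ)) =
        (reflect E : E × (E →L[ℂ] ℂ) →L[ℂ] E × (E →L[ℂ] ℂ)) := by
    refine (mfderiv_comp z (hr.mdifferentiableAt (by simp))
      (mdifferentiableAt_extChartAt (mem_chart_source _ z))).trans ?_
    rw [mfderiv_extChartAt_self, mfderiv_eq_fderiv, ContinuousLinearEquiv.fderiv]
    rfl
  have h2 : reflect E v = 0 := by
    refine Form.eq_zero_of_d_liouville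
      ((reflect E ∘ extChartAt 𝓘(ℂ, E × (E →L[ℂ] ℂ)) z) z) _ fun w => ?_
    have h3 := h ((reflect E).symm w)
    refine Eq.trans ?_ h3
    have h4 : (![reflect E v, w] : Fin 2 → E × (E →L[ℂ] ℂ)) =
        (mfderiv 𝓘(ℂ, E × (E →L[ℂ] ℂ)) 𝓘(ℂ, E × (E →L[ℂ] ℂ))
          (reflect E ∘ extChartAt 𝓘(ℂ, E × (E →L[ℂ] ℂ)) z) z :
            E × (E →L[ℂ] ℂ) →L[ℂ] E × (E →L[ℂ] ℂ)) ∘ ![v, (reflect E).symm w] := by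
      rw [h1]
      funext i
      fin_cases i
      · rfl
      · exact ((reflect E).apply_symm_apply w).symm
    exact congrArg _ h4
  exact (reflect E).map_eq_zero_iff.1 h2

/-! ### Tangent spaces of the fibres C_c and maps into them -/

theorem mfderiv_incl {c : ℂ} (z : Q.C c) (u : E × (E →L[ℂ] ℂ)) :
    (mfderiv 𝓘(ℂ, E × (E →L[ℂ] ℂ)) (IZ E) C.incl z :
      E × (E →L[ℂ] ℂ) →L[ℂ] E × (ℂ × (E →L[ℂ] ℂ))) u =
        ((u.1, (0, u.2)) : E × (ℂ × (E →L[ℂ] ℂ))) := by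
  have h1 := mfderiv_comp z (mdifferentiableAt_extChartAt (I := IZ E)
    (mem_chart_source _ z.incl)) ((contMDiff_incl c z).mdifferentiableAt (by simp))
  have hs : MDifferentiableAt 𝓘(ℂ, E × (E →L[ℂ] ℂ)) 𝓘(ℂ, E × (ℂ × (E →L[ℂ] ℂ))) (slice c)
      (extChartAt 𝓘(ℂ, E × (E →L[ℂ] ℂ)) z z) :=
    ((contDiff_slice c).differentiable (by simp) _).mdifferentiableAt
  have h2 := mfderiv_comp z hs
    (mdifferentiableAt_extChartAt (I := 𝓘(ℂ, E × (E →L[ℂ] ℂ))) (mem_chart_source _ z))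
  have h3 : extChartAt (IZ E) z.incl ∘ (C.incl : Q.C c → Q.Z) =
      slice c ∘ extChartAt 𝓘(ℂ, E × (E →L[ℂ] ℂ)) z :=
    funext fun z' => (slice_forget z.incl z').symm
  rw [h3, h2, mfderiv_extChartAt_self, mfderiv_extChartAt_self, mfderiv_eq_fderiv] at h1
  have h4 : HasFDerivAt (slice (E := E) c) ((ContinuousLinearMap.fst ℂ E (E →L[ℂ] ℂ)).prod
      ((0 : E × (E →L[ℂ] ℂ) →L[ℂ] ℂ).prod (ContinuousLinearMap.snd ℂ E (E →L[ℂ] ℂ))))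
      (extChartAt 𝓘(ℂ, E × (E →L[ℂ] ℂ)) z z) :=
    hasFDerivAt_fst.prodMk ((hasFDerivAt_const _ _).prodMk hasFDerivAt_snd)
  rw [h4.fderiv] at h1
  exact (DFunLike.congr_fun h1 u).symm

theorem dlam_apply (z : Q.Z) (v : E × (ℂ × (E →L[ℂ] ℂ))) : dlam z v = v.2.1 := by
  have h2 : (lam : Q.Z → ℂ) = (fun y : E × (ℂ × (E →L[ℂ] ℂ)) => y.2.1) ∘ extChartAt (IZ E) z :=
    funext fun z' => (zchart_scalar z z').symm
  have h3 : HasFDerivAt (fun y : E × (ℂ × (E →L[ℂ] ℂ)) => y.2.1)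
      ((ContinuousLinearMap.fst ℂ ℂ (E →L[ℂ] ℂ)).comp
        (ContinuousLinearMap.snd ℂ E (ℂ × (E →L[ℂ] ℂ)))) (extChartAt (IZ E) z z) :=
    ((ContinuousLinearMap.fst ℂ ℂ (E →L[ℂ] ℂ)).comp
        (ContinuousLinearMap.snd ℂ E (ℂ × (E →L[ℂ] ℂ)))).hasFDerivAt
  have h1 := mfderiv_comp z h3.differentiableAt.mdifferentiableAt
    (mdifferentiableAt_extChartAt (I := IZ E) (mem_chart_source _ z))
  rw [← h2, mfderiv_extChartAt_self, mfderiv_eq_fderiv, h3.fderiv] at h1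
  exact DFunLike.congr_fun h1 v

/-- In coordinates ker dλ consists of the vectors with zero λ-component, and these are the tangent
vectors of the slice. A relative form is therefore determined by its restrictions to the fibres C_c.
-/
theorem dincl_surjective {c : ℂ} (z : Q.C c) : Function.Surjective (dincl z) := by
  rintro ⟨v, hv⟩
  have h1 : (show E × (ℂ × (E →L[ℂ] ℂ)) from v).2.1 = 0 := (dlam_apply z.incl v).symm.trans hv
  refine ⟨((show E × (ℂ × (E →L[ℂ] ℂ)) from v).1, (show E × (ℂ × (E →L[ℂ] ℂ)) from v).2.2),
    Subtype.ext ?_⟩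
  refine (mfderiv_incl z _).trans ?_
  exact Prod.ext rfl (Prod.ext h1.symm rfl)

theorem contMDiffAt_C {F : Type*} [NormedAddCommGroup F] [NormedSpace ℂ F]
    {H : Type*} [TopologicalSpace H] {I : ModelWithCorners ℂ F H}
    {M : Type*} [TopologicalSpace M] [ChartedSpace H M] {c : ℂ} {f : M → Q.C c} {m : M}
    (h : ContMDiffAt I (IZ E) ω (C.incl ∘ f) m) :
    ContMDiffAt I 𝓘(ℂ, E × (E →L[ℂ] ℂ)) ω f m := by
  rw [contMDiffAt_iff_target]
  refine ⟨(isInducing_incl c).continuousAt_iff.2 h.continuousAt, ?_⟩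
  have h1 : ContMDiffAt (IZ E) 𝓘(ℂ, E × (ℂ × (E →L[ℂ] ℂ))) ω (extChartAt (IZ E) (f m).incl)
      ((C.incl ∘ f) m) := contMDiffAt_extChartAt
  have h2 : ContMDiff 𝓘(ℂ, E × (ℂ × (E →L[ℂ] ℂ))) 𝓘(ℂ, E × (E →L[ℂ] ℂ)) ω (forget (E := E)) :=
    contDiff_forget.contMDiff
  exact h2.contMDiffAt.comp m (h1.comp m h)

/-! ### Comparison of C_0 with T*X -/

theorem cotan_negIota {e : Trivialization ℂˣ Q.proj} (he : IsLocalTriv (E := E) (EP := EP) e)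
    {x : X} (hx : x ∈ e.baseSet) (a : E →L[ℂ] ℂ) :
    cotan e (negIota x a : Q.WFib x) = -a := by
  ext v
  exact dlog_fund he (fib_mem_source hx (Q.pt x)) (-a v)

/-- In bundle coordinates the map is (x, η) ↦ (x, 0, -η). -/
theorem contMDiff_ofCovector :
    ContMDiff (IT E) 𝓘(ℂ, E × (E →L[ℂ] ℂ)) ω (ofCovector : CotSpace E X → Q.C 0) := by
  intro ξ₀
  refine contMDiffAt_C ?_
  have hid := (Bundle.contMDiffAt_totalSpace (IM := IT E) (IB := 𝓘(ℂ, E)) (n := ω)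
    (f := (id : CotSpace E X → CotSpace E X)) (x₀ := ξ₀)).1 contMDiffAt_id
  refine (Bundle.contMDiffAt_totalSpace (IM := IT E) (IB := 𝓘(ℂ, E)) (n := ω)
    (f := C.incl ∘ (ofCovector : CotSpace E X → Q.C 0)) (x₀ := ξ₀)).2 ⟨hid.1, ?_⟩
  have h1 : ContMDiffAt (IT E) 𝓘(ℂ, ℂ × (E →L[ℂ] ℂ)) ω
      (fun ξ : CotSpace E X => ((0 : ℂ), -(cotTriv E ξ₀.proj ξ).2)) ξ₀ :=
    ((contDiff_const.prodMk contDiff_neg).contMDiff.contMDiffAt).comp ξ₀ hid.2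
  refine h1.congr_of_eventuallyEq ?_
  filter_upwards [eventually_mem_chartAt_source (E := E) (m₀ := ξ₀) hid.1.continuousAt,
    hid.1.continuousAt.eventually ((Q.triv ξ₀.proj).open_baseSet.mem_nhds (mem_triv Q ξ₀.proj))]
    with ξ h2 h3
  refine Prod.ext rfl ?_
  have hb : ξ.proj ∈ (cotTriv E ξ₀.proj).baseSet := ⟨h2, trivial⟩
  refine Eq.trans ?_ (((cotTriv E ξ₀.proj).linear ℂ hb).map_neg ξ.2)
  exact congrArg (fun a => (cotTriv E ξ₀.proj ⟨ξ.proj, toCot ξ.proj a⟩).2)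
    (cotan_negIota (isLocalTriv_triv Q ξ₀.proj) h3 (ofCot ξ.2))

/-- As d commutes with pullback, it suffices to compare 1-forms near ξ₀. The minus sign of the
potential cancels the one of `cotan_negIota`, and what remains is ξ composed with the differential
of the projection. -/
theorem pullback_ofCovector_restrict_relForm :
    ((relForm Q).restrict 0).pullback (J := IT E) ofCovector = stdForm E X := by
  funext ξ₀
  set e := Q.triv ξ₀.proj
  have hA : (Form.pullback (J := 𝓘(ℂ, E × (E →L[ℂ] ℂ))) C.incl
      (potential e)).HolomorphicAt (ofCovector (Q := Q) ξ₀) :=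
    (holomorphicAt_potential_triv (ofCovector (Q := Q) ξ₀).incl).pullback (contMDiff_incl 0 _)
  -- The trivialization in `restrict_relForm` varies with the point; the equality is used only at
  -- ξ₀, where it is `e`.
  have h1 : ((relForm Q).restrict 0).pullback (J := IT E) ofCovector ξ₀ =
      Form.pullback (J := IT E) ofCovector (Form.pullback (J := 𝓘(ℂ, E × (E →L[ℂ] ℂ))) C.incl
        (potential e)).d ξ₀ := by
    unfold Form.pullback
    rw [restrict_relForm]
    rfl
  rw [h1, ← Form.d_pullback hA (contMDiff_ofCovector ξ₀)]
  refine Form.d_congr ?_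
  have hpr := (Bundle.contMDiffAt_proj (n := ω) (IB := 𝓘(ℂ, E)) (F := E →L[ℂ] ℂ) (Cot E X)
    (p := ξ₀)).continuousAt
  filter_upwards [hpr.eventually (e.open_baseSet.mem_nhds (mem_triv Q ξ₀.proj))] with ξ hξ
  have h2 := (contMDiff_incl 0 (ofCovector (Q := Q) ξ)).mdifferentiableAt (by simp)
  have h3 := (contMDiff_ofCovector (Q := Q) ξ).mdifferentiableAt (by simp)
  refine (Form.pullback_pullback (potential e) h2 h3).trans ?_
  have h4 := mfderiv_comp ξ ((contMDiffAt_Z_proj (ofCovector (Q := Q) ξ).incl).mdifferentiableAt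
    (by simp)) (h2.comp ξ h3)
  refine Form.ofCovectors_congr (I := IT E) (θ := fun ξ => ((-cotan e (ofCovector (Q := Q) ξ).incl.2) ∘L
    (mfderiv (IZ E) 𝓘(ℂ, E) (TotalSpace.proj : Q.Z → X) (ofCovector (Q := Q) ξ).incl ∘L
    (mfderiv (IT E) (IZ E) (C.incl ∘ (ofCovector : CotSpace E X → Q.C 0)) ξ :
      E × (E →L[ℂ] ℂ) →L[ℂ] E × (ℂ × (E →L[ℂ] ℂ)))) : E × (E →L[ℂ] ℂ) →L[ℂ] ℂ)) fun v => ?_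
  have h5 : cotan e (ofCovector (Q := Q) ξ).incl.2 = -ofCot ξ.2 :=
    cotan_negIota (isLocalTriv_triv Q ξ₀.proj) hξ (ofCot ξ.2)
  change (-cotan e (ofCovector (Q := Q) ξ).incl.2) _ = _
  rw [h5, neg_neg]
  exact congrArg (ofCot ξ.2) (DFunLike.congr_fun h4 v).symm

end PrincipalBundle

/-! ### The universal connection and the independence of the trivialization -/

namespace PrincipalBundle

variable {E : Type*} [NormedAddCommGroup E] [NormedSpace ℂ E]
  {X : Type*} [TopologicalSpace X] [ChartedSpace E X]
  {EP : Type*} [NormedAddCommGroup EP] [NormedSpace ℂ EP]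
  {P : Type*} [TopologicalSpace P] [ChartedSpace EP P] [MulAction ℂˣ P]
  {Q : PrincipalBundle E X EP P} [FiniteDimensional ℂ E] [IsManifold 𝓘(ℂ, E) ω X]
  [FiniteDimensional ℂ EP]

/-- Since `dlog e` is a left inverse of ι, applying it to ι(s_w(u)) = λu - w(dπ u) isolates s_w(u).
-/
theorem connForm_eq {e : Trivialization ℂˣ Q.proj} (he : IsLocalTriv (E := E) (EP := EP) e)
    {x : X} (hx : x ∈ e.baseSet) (w : Q.WFib x) (p : Q.Fib x) (u : EP) :
    connForm w p u = w.scalar * dlog e p.1 u - cotan e w (Q.dProj p.1 u) := by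
  have h1 := dlog_fund he (fib_mem_source hx p) (connForm w p u)
  rw [fund_connForm] at h1
  have h2 := map_add (dlog e p.1) (w.scalar • u : EP)
    ((-1 : ℂ) • (show EP from w.val (Q.dProj p.1 u) p))
  have h3 := map_smul (dlog e p.1) w.scalar u
  have h4 := map_smul (dlog e p.1) (-1 : ℂ) (show EP from w.val (Q.dProj p.1 u) p)
  have h5 := cotan_apply he hx w (Q.dProj p.1 u) p
  rw [h3, h4] at h2
  refine (h1.symm.trans h2).trans ?_
  rw [smul_eq_mul, smul_eq_mul, neg_one_mul, ← sub_eq_add_neg]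
  exact congrArg (fun t : ℂ => w.scalar * dlog e p.1 u - t) h5.symm

/-- The section enters only through the dlog term: the cotan term sees it through π ∘ s = q, which
is the same for all sections. -/
theorem univForm_eq {c : ℂ} (s : ∀ z : Q.C c, Q.Fib z.base) {e : Trivialization ℂˣ Q.proj}
    (he : IsLocalTriv (E := E) (EP := EP) e) {z : Q.C c} (hz : z.base ∈ e.baseSet)
    (hs : ContMDiffAt 𝓘(ℂ, E × (E →L[ℂ] ℂ)) 𝓘(ℂ, EP) ω (fun z => (s z).1) z) :
    univForm s z = (Form.pullback (J := 𝓘(ℂ, E × (E →L[ℂ] ℂ))) C.incl (potential e) +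
      Form.pullback (J := 𝓘(ℂ, E × (E →L[ℂ] ℂ))) (fun z => coord e (s z).1)
        (Form.dlogForm c) : Form 𝓘(ℂ, E × (E →L[ℂ] ℂ)) (Q.C c) 1) z := by
  have hp := fib_mem_source hz (s z)
  have h1 := chain (f := fun z => (s z).1) rfl (contMDiffAt_coord he hp) hs
  have h2 := chain (f := fun z => (s z).1) rfl (Q.contMDiffAt_proj (s z).1) hs
  have h3 := mfderiv_comp z ((contMDiffAt_Z_proj z.incl).mdifferentiableAt (by simp))
    ((contMDiff_incl c z).mdifferentiableAt (by simp))
  have h4 : Q.proj ∘ (fun z : Q.C c => (s z).1) = TotalSpace.proj ∘ C.incl :=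
    funext fun z => (s z).2
  rw [h4] at h2
  refine Form.ofCovectors_congr (I := 𝓘(ℂ, E × (E →L[ℂ] ℂ))) (θ' := fun z : Q.C c =>
    ((((-cotan e z.incl.2) ∘L
      (mfderiv (IZ E) 𝓘(ℂ, E) (TotalSpace.proj : Q.Z → X) z.incl :
        E × (ℂ × (E →L[ℂ] ℂ)) →L[ℂ] E)) ∘L
      (mfderiv 𝓘(ℂ, E × (E →L[ℂ] ℂ)) (IZ E) C.incl z :
        E × (E →L[ℂ] ℂ) →L[ℂ] E × (ℂ × (E →L[ℂ] ℂ)))) +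
      ((c * (coord e (s z).1)⁻¹) • ContinuousLinearMap.id ℂ ℂ : ℂ →L[ℂ] ℂ) ∘L
        (mfderiv 𝓘(ℂ, E × (E →L[ℂ] ℂ)) 𝓘(ℂ, ℂ) (fun z : Q.C c => coord e (s z).1) z :
          E × (E →L[ℂ] ℂ) →L[ℂ] ℂ) : E × (E →L[ℂ] ℂ) →L[ℂ] ℂ)) fun v => ?_
  set u : EP := (mfderiv 𝓘(ℂ, E × (E →L[ℂ] ℂ)) 𝓘(ℂ, EP) (fun z : Q.C c => (s z).1) z :
    E × (E →L[ℂ] ℂ) →L[ℂ] EP) v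
  have h5 : (mfderiv 𝓘(ℂ, E × (E →L[ℂ] ℂ)) 𝓘(ℂ, ℂ) (fun z : Q.C c => coord e (s z).1) z :
      E × (E →L[ℂ] ℂ) →L[ℂ] ℂ) v = dcoord (EP := EP) e (s z).1 u := DFunLike.congr_fun h1 v
  have h6 : (mfderiv (IZ E) 𝓘(ℂ, E) (TotalSpace.proj : Q.Z → X) z.incl :
      E × (ℂ × (E →L[ℂ] ℂ)) →L[ℂ] E) ((mfderiv 𝓘(ℂ, E × (E →L[ℂ] ℂ)) (IZ E) C.incl z :
        E × (E →L[ℂ] ℂ) →L[ℂ] E × (ℂ × (E →L[ℂ] ℂ))) v) = Q.dProj (s z).1 u :=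
    (DFunLike.congr_fun h3 v).symm.trans (DFunLike.congr_fun h2 v)
  -- This is where λ becomes the constant c, by `z.lam_incl`.
  have h7 : ∀ l t k a : ℂ, l = c → l * (k⁻¹ * a) - t = -t + (c * k⁻¹) * a := by
    rintro l t k a rfl; ring
  refine (connForm_eq he hz z.incl.2 (s z) u).trans ((h7 _ _ (coord e (s z).1)
    (dcoord (EP := EP) e (s z).1 u) z.lam_incl).trans ?_)
  exact (congrArg₂ (fun (a : E) (b : ℂ) => -cotan e z.incl.2 a + (c * (coord e (s z).1)⁻¹) * b)
    h6 h5).symm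

/-- The exterior derivative of the form of the universal connection does not depend on the local
section. -/
theorem d_univForm {c : ℂ} (s : ∀ z : Q.C c, Q.Fib z.base) {e : Trivialization ℂˣ Q.proj}
    (he : IsLocalTriv (E := E) (EP := EP) e) {z : Q.C c} (hz : z.base ∈ e.baseSet)
    (hs : ContMDiffAt 𝓘(ℂ, E × (E →L[ℂ] ℂ)) 𝓘(ℂ, EP) ω (fun z => (s z).1) z)
    (hpot : (potential e).HolomorphicAt z.incl) [IsManifold 𝓘(ℂ, EP) ω P] :
    (univForm s).d z =
      (Form.pullback (J := 𝓘(ℂ, E × (E →L[ℂ] ℂ))) C.incl (potential e)).d z := by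
  have hbase : ContinuousAt (C.base : Q.C c → X) z :=
    (contMDiffAt_Z_proj z.incl).continuousAt.comp (contMDiff_incl c z).continuousAt
  have hcoord : ContMDiffAt 𝓘(ℂ, E × (E →L[ℂ] ℂ)) 𝓘(ℂ, ℂ) ω (fun z => coord e (s z).1) z :=
    (contMDiffAt_coord he (fib_mem_source hz (s z))).comp (f := fun z => (s z).1) z hs
  have h1 : ∀ᶠ z' in 𝓝 z, univForm s z' =
      (Form.pullback (J := 𝓘(ℂ, E × (E →L[ℂ] ℂ))) C.incl (potential e) +
      Form.pullback (J := 𝓘(ℂ, E × (E →L[ℂ] ℂ))) (fun z => coord e (s z).1)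
        (Form.dlogForm c) : Form 𝓘(ℂ, E × (E →L[ℂ] ℂ)) (Q.C c) 1) z' := by
    filter_upwards [hbase.eventually (e.open_baseSet.mem_nhds hz),
      (contMDiffAt_iff_contMDiffAt_nhds (by simp)).1 hs] with z' h2 h3
    exact univForm_eq s he h2 h3
  have h2 : (Form.pullback (J := 𝓘(ℂ, E × (E →L[ℂ] ℂ))) C.incl (potential e)).HolomorphicAt z :=
    hpot.pullback (contMDiff_incl c z)
  have hne : coord e (s z).1 ≠ 0 := coord_ne_zero (s z).1
  have h3 := Form.holomorphicAt_pullback_dlogForm c hcoord hne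
  have h4 := Form.d_pullback_dlogForm c hcoord hne
  exact (Form.d_congr h1).trans ((Form.d_add h2 h3).trans
    ((congrArg (fun η => _ + η) h4).trans (add_zero _)))

/-- The section is the constant 1 in a local trivialization. Its values outside the base set are
arbitrary points of the fibres, since only the germ at z matters. -/
theorem exists_local_section {c : ℂ} (z : Q.C c) :
    ∃ s : ∀ z : Q.C c, Q.Fib z.base,
      ContMDiffAt 𝓘(ℂ, E × (E →L[ℂ] ℂ)) 𝓘(ℂ, EP) ω (fun z => (s z).1) z := by
  classical
  obtain ⟨e, hz, he⟩ := Q.exists_triv z.base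
  have hbase : ContMDiffAt 𝓘(ℂ, E × (E →L[ℂ] ℂ)) 𝓘(ℂ, E) ω (C.base : Q.C c → X) z :=
    (contMDiffAt_Z_proj z.incl).comp z (contMDiff_incl c z)
  refine ⟨fun z => if h : z.base ∈ e.baseSet then
    ⟨e.toOpenPartialHomeomorph.symm (z.base, 1), e.proj_symm_apply (e.mem_target.2 h)⟩
    else Q.pt z.base, ?_⟩
  refine ((contMDiffAt_symm_left he hz 1).comp z hbase).congr_of_eventuallyEq ?_
  filter_upwards [hbase.continuousAt.eventually (e.open_baseSet.mem_nhds hz)] with z' h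
  simp only [dif_pos (show z'.base ∈ e.baseSet from h)]
  rfl

variable [IsManifold 𝓘(ℂ, EP) ω P]

/-- One section s, read in two trivializations, has one exterior derivative dA_s. By `d_univForm`
this equals the derivative of either potential on C_c, so the trivialization chosen at z in the
definition of `relForm` may be replaced by `e`. -/
theorem restrict_relForm_eq {c : ℂ} {z : Q.C c} {e : Trivialization ℂˣ Q.proj}
    (he : IsLocalTriv (E := E) (EP := EP) e) (hz : z.base ∈ e.baseSet)
    (hpot : (potential e).HolomorphicAt z.incl) :
    (relForm Q).restrict c z =
      (Form.pullback (J := 𝓘(ℂ, E × (E →L[ℂ] ℂ))) C.incl (potential e)).d z := by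
  obtain ⟨s, hs⟩ := exists_local_section z
  rw [restrict_relForm, ← d_univForm s (isLocalTriv_triv Q z.base) (mem_triv Q z.base) hs
    (holomorphicAt_potential_triv z.incl), d_univForm s he hz hs hpot]

theorem eventually_potential_triv (z₀ : Q.Z) :
    ∀ᶠ z in 𝓝 z₀, z.proj ∈ (Q.triv z₀.proj).baseSet ∧
      (potential (Q.triv z₀.proj)).HolomorphicAt z :=
  ((contMDiffAt_Z_proj z₀).continuousAt.eventually
    ((Q.triv z₀.proj).open_baseSet.mem_nhds (mem_triv Q z₀.proj))).and
      (holomorphicAt_potential_triv z₀).eventually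

theorem relForm_apply {c : ℂ} (z : Q.C c) {e : Trivialization ℂˣ Q.proj}
    (he : IsLocalTriv (E := E) (EP := EP) e) (hz : z.base ∈ e.baseSet)
    (hpot : (potential e).HolomorphicAt z.incl) (v : Fin 2 → (dlam z.incl).ker) :
    relForm Q z.incl v =
      (potential e).d z.incl fun i => (v i : TangentSpace (IZ E) z.incl) := by
  have h1 := restrict_relForm_eq he hz hpot
  rw [Form.d_pullback hpot (contMDiff_incl _ z)] at h1
  obtain ⟨u, rfl⟩ : ∃ u, (fun i => dincl z (u i)) = v :=
    ⟨fun i => (dincl_surjective z (v i)).choose,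
      funext fun i => (dincl_surjective z (v i)).choose_spec⟩
  exact DFunLike.congr_fun h1 u

/-- The definition of `relForm` picks a trivialization at each point separately. Independence of
that choice allows one potential, that of z₀, to induce it on a whole neighbourhood. -/
theorem holomorphic_relForm : (relForm Q).Holomorphic := by
  intro z₀
  obtain ⟨U, hU, hopen, hz₀⟩ := mem_nhds_iff.1 (eventually_potential_triv z₀)
  refine ⟨U, hopen, hz₀, (potential (Q.triv z₀.proj)).d, fun z hz => ?_⟩
  -- Every z of Z° lies on a fibre C_c, namely the one with c = λ(z).
  exact ⟨(hU hz).2.d, relForm_apply ⟨z, rfl⟩ (isLocalTriv_triv Q z₀.proj) (hU hz).1 (hU hz).2⟩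

theorem isHolomorphicSymplectic_restrict_relForm (c : ℂ) :
    ((relForm Q).restrict c).IsHolomorphicSymplectic := by
  have hloc (z₀ : Q.C c) : ∀ᶠ z in 𝓝 z₀, (relForm Q).restrict c z = (Form.pullback
      (J := 𝓘(ℂ, E × (E →L[ℂ] ℂ))) C.incl (potential (Q.triv z₀.base))).d z := by
    filter_upwards [(contMDiff_incl c z₀).continuousAt.eventually
      (eventually_potential_triv z₀.incl)] with z hz
    exact restrict_relForm_eq (isLocalTriv_triv Q z₀.base) hz.1 hz.2
  have hhol (z₀ : Q.C c) : (Form.pullback (J := 𝓘(ℂ, E × (E →L[ℂ] ℂ))) C.incl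
      (potential (Q.triv z₀.base))).HolomorphicAt z₀ :=
    (holomorphicAt_potential_triv z₀.incl).pullback (contMDiff_incl c z₀)
  exact
    { holomorphic := fun z₀ => (hhol z₀).d.congr (hloc z₀)
      closed := fun z₀ => (Form.d_congr (hloc z₀)).trans (hhol z₀).d_d
      nondegenerate := nondegenerate_restrict_relForm }

end PrincipalBundle
end CStar

end

theorem proposition3p3 {E : Type*} [NormedAddCommGroup E] [NormedSpace ℂ E] [FiniteDimensional ℂ E]
    {X : Type*} [TopologicalSpace X] [ChartedSpace E X] [IsManifold 𝓘(ℂ, E) ω X]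
    {EP : Type*} [NormedAddCommGroup EP] [NormedSpace ℂ EP] [FiniteDimensional ℂ EP]
    {P : Type*} [TopologicalSpace P] [ChartedSpace EP P] [IsManifold 𝓘(ℂ, EP) ω P]
    [MulAction ℂˣ P] (Q : CStar.PrincipalBundle E X EP P) :
    ∃ Ω : Q.RelForm, Ω.Holomorphic ∧
      (∀ c : ℂ, (Ω.restrict c).IsHolomorphicSymplectic) ∧
      (Ω.restrict 0).pullback (J := CStar.PrincipalBundle.IT E)
        CStar.PrincipalBundle.ofCovector = CStar.PrincipalBundle.stdForm E X ∧
      ∀ (c : ℂ) (V : Set (Q.C c)) (s : ∀ z : Q.C c, Q.Fib z.base), IsOpen V →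
        ContMDiffOn 𝓘(ℂ, E × (E →L[ℂ] ℂ)) 𝓘(ℂ, EP) ω (fun z => (s z).1) V →
        ∀ z ∈ V, Ω.restrict c z = (CStar.PrincipalBundle.univForm s).d z := by
  refine ⟨CStar.PrincipalBundle.relForm Q, CStar.PrincipalBundle.holomorphic_relForm,
    CStar.PrincipalBundle.isHolomorphicSymplectic_restrict_relForm,
    CStar.PrincipalBundle.pullback_ofCovector_restrict_relForm, ?_⟩
  -- The identity is pointwise, so z can be treated with its own trivialization, the one used in
  -- `relForm`.
  intro c V s hV hs z hz
  rw [CStar.PrincipalBundle.restrict_relForm]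
  exact (CStar.PrincipalBundle.d_univForm s (CStar.PrincipalBundle.isLocalTriv_triv Q z.base)
    (CStar.PrincipalBundle.mem_triv Q z.base) (hs.contMDiffAt (hV.mem_nhds hz))
    (CStar.PrincipalBundle.holomorphicAt_potential_triv z.incl)).symm
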